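/- Consider a finite directed graph with node set $\mathcal V=\{0,\dots,N-1\}$, link set $\mathcal L$ and gateway node $0$, and for every link $(i,j)\in\mathcal L$ a queue with buffer size $B_{ij}\in\{0,1,2,\dots\}\cup\{\infty\}$. Update packets $l=1,2,\dots$ are generated at an external source at times $0\le s_1\le s_2\le\cdots$; packet $l$ reaches the gateway at time $a_{l0}\ge s_l$. The $a_{l0}$ are otherwise arbitrary (packets may reach the gateway out of order of generation), except that only finitely many packets reach it in any bounded time interval. A packet that arrives at a node is at once available to all outgoing links of the node, all links can transmit simultaneously, and a packet whose transmission over $(i,j)$ is completed arrives at $j$. The system starts empty at time $0$. Collect these data in $\mathcal I=\{(\mathcal V,\mathcal L),(B_{ij}),(s_l),(a_{l0})\}$. The duration of the $k$-th transmission on link $e\in\mathcal L$ is exponentially distributed with a rate $\mu_e>0$, and all these durations are independent (over $e$ and $k$). A causal policy decides, at the start, at arrivals and deliveries, and at further times of its own choice, which available packet is in transmission on each link (preemption and idling are allowed; a preempted packet may be stored back into the queue if there is room and be sent again later in a new transmission) and which packets are stored in the queue of each link, subject to the buffer sizes; packets other than preempted ones and repeated copies are lost only when the buffer is full. Decisions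 depend measurably on the history of the system (and possibly on an independent private randomization), not on the durations of uncompleted transmissions. Let $\Pi$ be the set of causal policies. A policy is preemptive LGFS (Last-Generated, First-Served) if it makes decisions only when packets arrive or are delivered and if, on each link, it always transmits an available packet with the largest generation time, preempts a transmission only in favour of a packet with a strictly larger generation time, and idles only if no packet is available; which packets are lost at a full buffer, and whether repeated copies of a packet that a node has already received are accepted, is left open. For a policy $\pi$ let $U_{j,\pi}(t)$ be the largest generation time of the packets that have arrived at node $j$ by time $t$ ($0$ if there is none), and let $\mathbf\Delta_\pi(t)=(t-U_{0,\pi}(t),\dots,t-U_{N-1,\pi}(t))$, $t\ge 0$, be the age process of all nodes. Theorem. For all $\mathcal I$ and all rates $(\mu_e)$, preemptive LGFS policies exist in $\Pi$, and for every preemptive LGFS policy $P\in\Pi$ and every $\pi\in\Pi$, $$[\mathbf\Delta_{P}\mid\mathcal I]\le_{\rm st}[\mathbf\Delta_\pi\mid\mathcal I],$$ that is, for all $n$, all $0\le t_1<\dots<t_n$ and every measurable upper set $U\subseteq\mathbb R^{nN}$, $\mathbb P\{(\mathbf\Delta_P(t_1),\dots,\mathbf\Delta_P(t_n))\in U\}\le\mathbb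 P\{(\mathbf\Delta_\pi(t_1),\dots,\mathbf\Delta_\pi(t_n))\in U\}$. Moreover (equivalently), for every functional $g$ with $g(\mathbf\Delta_1)\le g(\mathbf\Delta_2)$ whenever $\mathbf\Delta_1(t)\le\mathbf\Delta_2(t)$ for all $t\ge0$, $$\mathbb E[g(\mathbf\Delta_P)\mid\mathcal I]=\min_{\pi\in\Pi}\mathbb E[g(\mathbf\Delta_\pi)\mid\mathcal I],$$ provided that the expectations exist. -/

import Mathlib

open MeasureTheory ProbabilityTheory
open scoped NNReal ENNReal

noncomputable section

namespace MultihopAge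

/-- The parameters of the model: a finite directed graph whose nodes are `0, …, last`
(node `0` is the gateway), a buffer size (possibly zero or infinite) for every link, and the
generation times `s l` of the update packets `l = 0, 1, 2, …` at the external source together with
their arrival times `a l` at the gateway.  Packets may reach the gateway out of the order of their
generation, but only finitely many reach it in a bounded time interval. -/
structure Network where
  last : ℕ
  links : Finset (Fin (last + 1) × Fin (last + 1))
  buffer : {p // p ∈ links} → ℕ∞
  s : ℕ → ℝ
  a : ℕ → ℝ
  s_nonneg : ∀ l, 0 ≤ s l
  s_mono : Monotone s
  s_le_a : ∀ l, s l ≤ a l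
  finite_arrivals : ∀ t : ℝ, {l | a l ≤ t}.Finite

namespace Network

/-- The nodes of the network. -/
abbrev Node (net : Network) : Type := Fin (net.last + 1)

/-- The links of the network; a link is the pair (origin, destination). -/
abbrev Link (net : Network) : Type := {p : net.Node × net.Node // p ∈ net.links}

/-- What is observed at an epoch: the time, and the set of links that complete a transmission. -/
abbrev Obs (net : Network) : Type := ℝ × Set net.Link

/-- The observations made since the start, the most recent one first.  The empty history belongs to
the start of the system at time `0`. -/
abbrev History (net : Network) : Type := List net.Obs

/-- The time of the most recent epoch. -/
def now {net : Network} : net.History → ℝ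
  | [] => 0
  | o :: _ => o.1

end Network

open Network

/-- A control rule.  At every epoch, given the history (and the outcome `r` of a private
randomization), it fixes, until the next epoch: the packet in transmission on each link (`none` for
an idle link), the set of packets stored in the queue of each link, and the time `timer` after which
it wants to decide anew even if nothing happens until then (`⊤` if it does not). An epoch is the
start of the system, an arrival of a packet at the gateway, the completion of a transmission, or the
expiry of the timer. The own past decisions, and with them the location and the arrival times of all
the packets, are determined by the history; the duration of a transmission is
not part of it before the transmission is completed. -/
structure Rule (net : Network) (R : Type*) where
  serve : R → net.History → net.Link → Option ℕ
  queue : R → net.History → net.Link → Finset ℕ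
  timer : R → net.History → ℝ≥0∞

namespace Rule

variable {net : Network} {R : Type*}

/-- The packets that arrive at node `v` at the most recent epoch: those delivered to `v` by the
links that have just completed a transmission, and, at the gateway, those coming from the source. -/
def arrivals (ρ : Rule net R) (r : R) : net.History → net.Node → Set ℕ
  | [], v => {l | v = 0 ∧ net.a l = 0}
  | o :: h, v => {l | (v = 0 ∧ net.a l = o.1) ∨
      ∃ e ∈ o.2, e.1.2 = v ∧ ρ.serve r h e = some l}

/-- The packets that have arrived at node `v` before the most recent epoch. -/
def receivedBefore (ρ : Rule net R) (r : R) : net.History → net.Node → Set ℕ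
  | [], _ => ∅
  | _ :: h, v => ρ.receivedBefore r h v ∪ ρ.arrivals r h v

open Classical in
/-- The packet whose transmission on link `e` is under way when the decision at the most recent
epoch is made. -/
def current (ρ : Rule net R) (r : R) : net.History → net.Link → Option ℕ
  | [], _ => none
  | o :: h, e => if e ∈ o.2 then none else ρ.serve r h e

/-- The content of the queue of link `e` when the decision at the most recent epoch is made. -/
def waiting (ρ : Rule net R) (r : R) : net.History → net.Link → Finset ℕ
  | [], _ => ∅
  | _ :: h, e => ρ.queue r h e

/-- The packets that are at the disposal of link `e`: the one in transmission, those in the queue,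
and those that have just arrived at the origin of the link. -/
def available (ρ : Rule net R) (r : R) (h : net.History) (e : net.Link) : Set ℕ :=
  {l | ρ.current r h e = some l ∨ l ∈ ρ.waiting r h e ∨ l ∈ ρ.arrivals r h e.1.1}

/-- The available packets without the just arrived further copies of packets that the node had
already received before.  (Such copies may be accepted or discarded at will.) -/
def essential (ρ : Rule net R) (r : R) (h : net.History) (e : net.Link) : Set ℕ :=
  {l | ρ.current r h e = some l ∨ l ∈ ρ.waiting r h e ∨
    (l ∈ ρ.arrivals r h e.1.1 ∧ l ∉ ρ.receivedBefore r h e.1.1)}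

/-- The packets among which link `e` chooses: the essential ones and those repeated copies that it
accepts, for transmission or storage. -/
def contenders (ρ : Rule net R) (r : R) (h : net.History) (e : net.Link) : Set ℕ :=
  {l | l ∈ ρ.essential r h e ∨ l ∈ ρ.queue r h e ∨ ρ.serve r h e = some l}

/-- A new transmission starts on link `e` at the most recent epoch. If a transmission is under
way on the link then it is thereby preempted. -/
def Starts (ρ : Rule net R) (r : R) (h : net.History) (e : net.Link) : Prop :=
  ∃ l, ρ.serve r h e = some l ∧ ρ.current r h e ≠ some l

open Classical in
/-- The number of transmissions started on link `e` so far. -/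
def started (ρ : Rule net R) (r : R) : net.History → net.Link → ℕ
  | [], e => if ρ.Starts r [] e then 1 else 0
  | o :: h, e => ρ.started r h e + if ρ.Starts r (o :: h) e then 1 else 0

open Classical in
/-- The time at which the latest transmission started on link `e` is completed if it is not
preempted, when the `k`-th transmission (`k = 0, 1, …`) on link `e` takes the time `x (e, k)`. -/
def finish (ρ : Rule net R) (r : R) (x : net.Link × ℕ → ℝ) : net.History → net.Link → ℝ
  | [], e => x (e, 0)
  | o :: h, e =>
      if ρ.Starts r (o :: h) e then o.1 + x (e, ρ.started r h e) else ρ.finish r x h e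

/-- The time of the next epoch: the earliest of the future arrivals at the gateway, the
completions of the transmissions under way, and the expiry of the timer. -/
def nextTime (ρ : Rule net R) (r : R) (x : net.Link × ℕ → ℝ) (h : net.History) : ℝ :=
  sInf ({t | now h < t ∧ ∃ l, net.a l = t} ∪
    {t | ∃ e, ρ.serve r h e ≠ none ∧ ρ.finish r x h e = t} ∪
    {t | ρ.timer r h ≠ ⊤ ∧ now h + (ρ.timer r h).toReal = t})

/-- The observation made at the next epoch. -/
def nextObs (ρ : Rule net R) (r : R) (x : net.Link × ℕ → ℝ) (h : net.History) : net.Obs :=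
  (ρ.nextTime r x h, {e | ρ.serve r h e ≠ none ∧ ρ.finish r x h e = ρ.nextTime r x h})

/-- The history after `n` epochs when the system is run under the rule `ρ`, with private
randomization `ω.1` and transmission times `ω.2`. -/
def run (ρ : Rule net R) (ω : R × (net.Link × ℕ → ℝ)) : ℕ → net.History
  | 0 => []
  | n + 1 => ρ.nextObs ω.1 ω.2 (ρ.run ω n) :: ρ.run ω n

/-- Packet `l` has arrived at node `j` by time `t`. -/
def ArrivedBy (ρ : Rule net R) (ω : R × (net.Link × ℕ → ℝ)) (t : ℝ) (j : net.Node) (l : ℕ) : Prop :=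
  (j = 0 ∧ net.a l ≤ t) ∨ ∃ n, now (ρ.run ω n) ≤ t ∧ l ∈ ρ.arrivals ω.1 (ρ.run ω n) j

/-- The generation time of the freshest packet that has arrived at node `j` by time `t`
(initially `0`). -/
def freshest (ρ : Rule net R) (ω : R × (net.Link × ℕ → ℝ)) (t : ℝ) (j : net.Node) : ℝ :=
  sSup (insert 0 {u | ∃ l, ρ.ArrivedBy ω t j l ∧ net.s l = u})

/-- The age process of all the nodes. -/
def age (ρ : Rule net R) (ω : R × (net.Link × ℕ → ℝ)) (t : ℝ≥0) (j : net.Node) : ℝ :=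
  (t : ℝ) - ρ.freshest ω t j

end Rule

/-- A causal policy: a control rule, measurable in the (private randomization and the) history,
that respects what is at the disposal of each link and the buffer sizes, and loses packets
(other than preempted ones and repeated copies) only when the buffer is full. -/
structure CausalPolicy (net : Network) (R : Type*) [MeasurableSpace R] extends Rule net R where
  measurable_serve : ∀ (n : ℕ) (e : net.Link) (p : Option ℕ),
    MeasurableSet {q : R × (Fin n → net.Obs) | serve q.1 (List.ofFn q.2) e = p}
  measurable_queue : ∀ (n : ℕ) (e : net.Link) (F : Finset ℕ),
    MeasurableSet {q : R × (Fin n → net.Obs) | queue q.1 (List.ofFn q.2) e = F}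
  measurable_timer : ∀ n : ℕ,
    Measurable fun q : R × (Fin n → net.Obs) => timer q.1 (List.ofFn q.2)
  timer_pos : ∀ r h, 0 < timer r h
  serve_available : ∀ r h e l, serve r h e = some l → l ∈ toRule.available r h e
  queue_available : ∀ r h e, ∀ l ∈ queue r h e, l ∈ toRule.available r h e
  queue_ne_serve : ∀ r h e, ∀ l ∈ queue r h e, serve r h e ≠ some l
  queue_le_buffer : ∀ r h e, ((queue r h e).card : ℕ∞) ≤ net.buffer e
  lost_only_if_full : ∀ r h e, ∀ l ∈ toRule.essential r h e,
    serve r h e ≠ some l → l ∉ queue r h e → toRule.current r h e ≠ some l →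
      ((queue r h e).card : ℕ∞) = net.buffer e

/-- The preemptive Last-Generated, First-Served discipline. On every link: a packet with the
largest generation time is transmitted; a transmission under way is preempted only by a packet with
a larger generation time; the link idles only if there is nothing to transmit. Decisions are made
only when a packet arrives or is delivered.  Which packets are lost at a full buffer, and whether
repeated copies are accepted, is left open. -/
structure CausalPolicy.IsPreemptiveLGFS {net : Network} {R : Type*} [MeasurableSpace R]
    (π : CausalPolicy net R) : Prop where
  timer_eq_top : ∀ r h, π.timer r h = ⊤
  idle : ∀ r h e, π.serve r h e = none → π.contenders r h e = ∅
  freshest_first : ∀ r h e l, π.serve r h e = some l →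
    ∀ l' ∈ π.contenders r h e, net.s l' ≤ net.s l
  no_needless_preemption : ∀ r h e c, π.current r h e = some c →
    (∀ l' ∈ π.contenders r h e, net.s l' ≤ net.s c) → π.serve r h e = some c

/-- The joint law of the transmission times: the time of the `k`-th transmission on link `e` is
exponential with rate `rate e`, and all these times are independent. -/
def transmissionLaw {net : Network} (rate : net.Link → ℝ) (hrate : ∀ e, 0 < rate e) :
    Measure (net.Link × ℕ → ℝ) :=
  haveI : ∀ p : net.Link × ℕ, IsProbabilityMeasure (expMeasure (rate p.1)) :=
    fun p => isProbabilityMeasure_expMeasure (hrate p.1)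
  Measure.infinitePi fun p : net.Link × ℕ => expMeasure (rate p.1)

/-- The usual stochastic order of vector-valued stochastic processes on `[0, ∞)`: all
finite-dimensional distributions are ordered on the (measurable) upper sets. -/
def StochasticallySmaller {Ω Ω' ι : Type*} [MeasurableSpace Ω] [MeasurableSpace Ω']
    (μ : Measure Ω) (X : Ω → ℝ≥0 → ι → ℝ) (μ' : Measure Ω') (Y : Ω' → ℝ≥0 → ι → ℝ) : Prop :=
  (∀ t, AEMeasurable (fun ω => X ω t) μ) ∧ (∀ t, AEMeasurable (fun ω => Y ω t) μ') ∧
  ∀ (n : ℕ) (t : Fin n → ℝ≥0), StrictMono t →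
    ∀ U : Set (Fin n → ι → ℝ), IsUpperSet U → MeasurableSet U →
      μ {ω | (fun i => X ω (t i)) ∈ U} ≤ μ' {ω | (fun i => Y ω (t i)) ∈ U}

end MultihopAge

end

set_option linter.unusedSectionVars false

noncomputable section

namespace MultihopAge

/-! ### Exponential clocks -/

/-! Suppose that on every link a clock with exponential gaps ran all the time, and that each expiry
delivered the packet then in transmission, or nothing if the link is idle. With the same clocks for
two policies the comparison would be pathwise. Under preemptive LGFS a link always transmits a
packet at least as fresh as anything its origin has received, unless its destination already has
such a packet (`IsPreemptiveLGFS.exists_serve_or_arrival`). Hence after each expiry the destination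
is at least as fresh as the origin was before it (`IsPreemptiveLGFS.hasFresh_of_tick`). Every
delivery by the other policy also happens at an expiry and follows an arrival of the packet at the
origin, so induction over the events shows that LGFS is at least as fresh at every node
(`IsPreemptiveLGFS.hasFresh_of_arrival`).

In the model, by contrast, every transmission, also one that follows a preemption, takes a new
exponential time. Lack of memory reconciles the two pictures. Every link gets two rows of clocks.
Under `ownControl` the `true` row supplies the transmission times, the residual time being discarded
at a preemption, and the `false` row ticks while the link idles; under `commonControl` the `true`
row always runs. In both cases the clocks left after an event are independent of it and distributed
as at the start (`lintegral_race`), so the law of the path of times and histories depends on the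
rates and the dynamics, but not on the control (`Dynamics.map_path_eq`). That `ownControl`
reproduces the model is the content of `exists_run_eq` and `exists_state_eq_run`; the latter needs
the sums of the clocks to diverge, lest ticks of idle links accumulate before the next epoch.

Equality of laws becomes almost sure equality by `exists_coupling`: for each policy its own clocks
are coupled with common clocks that produce the same path, and the two couplings are glued along the
common clocks. This yields transmission times with the right law for both policies and almost surely
ordered ages (`IsPreemptiveLGFS.exists_coupling`). The private randomizations are frozen throughout;
as the comparison holds for every pair of their values, integrating over them is harmless. Existence
is separate: `lgfsPolicy` is an explicit greedy rule. -/

instance nullSingletonClass_expMeasure (r : ℝ) : NullSingletonClass (expMeasure r) :=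
  ⟨fun x => withDensity_absolutelyContinuous _ _ (measure_singleton x)⟩

lemma ae_pos_expMeasure (r : ℝ) : ∀ᵐ u ∂expMeasure r, 0 < u := by
  have h : expMeasure r (Set.Iio 0) = 0 := by
    unfold expMeasure gammaMeasure
    rw [withDensity_apply _ measurableSet_Iio]
    exact lintegral_gammaPDF_of_nonpos le_rfl
  have h0 : expMeasure r {0} = 0 := measure_singleton 0
  have : expMeasure r (Set.Iio 0 ∪ {0}) = 0 := measure_union_null h h0
  rw [ae_iff]
  refine measure_mono_null ?_ this
  intro u hu
  simp only [not_lt, Set.mem_ofPred_eq] at hu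
  rcases hu.lt_or_eq with h | h
  · exact Or.inl h
  · exact Or.inr h

/-- The exponential distribution has no memory. -/
lemma lintegral_exp_residual {r s : ℝ} (hs : 0 ≤ s) {g : ℝ → ℝ≥0∞} (hg : Measurable g) :
    ∫⁻ u, (if s < u then g (u - s) else 0) ∂expMeasure r =
      ENNReal.ofReal (Real.exp (-(r * s))) * ∫⁻ u, g u ∂expMeasure r := by
  have hpdf : Measurable (exponentialPDF r) := (measurable_exponentialPDFReal r).ennreal_ofReal
  have e : expMeasure r = volume.withDensity (exponentialPDF r) := rfl
  have hm : Measurable fun u => (if s < u then g (u - s) else 0) :=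
    Measurable.ite measurableSet_Ioi (by fun_prop) measurable_const
  rw [e, lintegral_withDensity_eq_lintegral_mul _ hpdf hm,
    lintegral_withDensity_eq_lintegral_mul _ hpdf hg,
    ← lintegral_const_mul _ (by fun_prop),
    ← lintegral_sub_right_eq_self (fun u => _ * (exponentialPDF r * g) u) s]
  refine lintegral_congr_ae ?_
  have h0 : ∀ᵐ u : ℝ, u ≠ s := by
    simp [ae_iff]
  filter_upwards [h0] with u hu
  simp only [Pi.mul_apply]
  rcases lt_or_gt_of_ne hu with h | h
  · rw [if_neg h.not_gt, exponentialPDF_of_neg (sub_neg.2 h)]; simp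
  · rw [if_pos h, exponentialPDF_of_nonneg (by linarith), exponentialPDF_of_nonneg (by linarith),
      ← mul_assoc, ← ENNReal.ofReal_mul (Real.exp_nonneg _)]
    congr 2
    rw [mul_left_comm, ← Real.exp_add]
    ring_nf

/-- Independent rows of independent exponential random variables, with rate `r c` in row `c`. -/
def rowLaw {κ : Type*} (r : κ → ℝ) (hr : ∀ c, 0 < r c) : Measure (κ × ℕ → ℝ) :=
  haveI : ∀ p : κ × ℕ, IsProbabilityMeasure (expMeasure (r p.1)) :=
    fun p => isProbabilityMeasure_expMeasure (hr p.1)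
  Measure.infinitePi fun p : κ × ℕ => expMeasure (r p.1)

instance isProbabilityMeasure_rowLaw {κ : Type*} (r : κ → ℝ) (hr : ∀ c, 0 < r c) :
    IsProbabilityMeasure (rowLaw r hr) := by
  have : ∀ p : κ × ℕ, IsProbabilityMeasure (expMeasure (r p.1)) :=
    fun p => isProbabilityMeasure_expMeasure (hr p.1)
  unfold rowLaw; infer_instance

/-- A product measure is invariant under injective changes of the index. -/
lemma infinitePi_map_comp_injective {ι ι' X : Type*} [MeasurableSpace X] (μ : ι → Measure X)
    [∀ i, IsProbabilityMeasure (μ i)] {σ : ι' → ι} (hσ : Function.Injective σ) :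
    (Measure.infinitePi μ).map (fun z i => z (σ i)) = Measure.infinitePi fun i => μ (σ i) := by
  classical
  refine Measure.eq_infinitePi _ fun s t ht => ?_
  have hm : Measurable fun (z : ι → X) i => z (σ i) := by fun_prop
  rw [Measure.map_apply hm (.pi s.countable_toSet fun i _ => ht i)]
  have hE : ∀ i, MeasurableSet (Function.extend σ t (fun _ => Set.univ) i) := by
    intro i
    by_cases h : ∃ a, σ a = i
    · obtain ⟨a, rfl⟩ := h
      rw [hσ.extend_apply]; exact ht a
    · rw [Function.extend_apply' _ _ _ h]; exact .univ
  have : (fun (z : ι → X) i => z (σ i)) ⁻¹' (Set.pi s t) =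
      Set.pi (s.image σ : Finset ι) (Function.extend σ t fun _ => Set.univ) := by
    ext z
    simp [Set.mem_pi, hσ.extend_apply]
  rw [this, Measure.infinitePi_pi _ (fun i _ => hE i), Finset.prod_image fun a _ b _ h => hσ h]
  simp [hσ.extend_apply]

lemma rowLaw_map_comp_injective {κ κ' : Type*} (r : κ → ℝ) (hr : ∀ c, 0 < r c)
    (r' : κ' → ℝ) (hr' : ∀ c, 0 < r' c) {σ : κ' × ℕ → κ × ℕ} (hσ : Function.Injective σ)
    (h : ∀ p, r (σ p).1 = r' p.1) :
    (rowLaw r hr).map (fun z i => z (σ i)) = rowLaw r' hr' := by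
  have : ∀ p : κ × ℕ, IsProbabilityMeasure (expMeasure (r p.1)) :=
    fun p => isProbabilityMeasure_expMeasure (hr p.1)
  unfold rowLaw
  rw [infinitePi_map_comp_injective _ hσ]
  congr 1
  funext p
  rw [h p]

/-! ### Inserting, aging and comparing clocks in independent rows -/

section Rows

variable {κ : Type*} [DecidableEq κ]

/-- Put `u` in front of row `c`. -/
def push (c : κ) (u : ℝ) (z : κ × ℕ → ℝ) : κ × ℕ → ℝ
  | (c', 0) => if c' = c then u else z (c', 0)
  | (c', k + 1) => if c' = c then z (c', k) else z (c', k + 1)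

/-- Subtract `s` from the first entries of the rows in `J`. -/
def advance (J : Finset κ) (s : ℝ) (z : κ × ℕ → ℝ) : κ × ℕ → ℝ :=
  fun p => if p.1 ∈ J ∧ p.2 = 0 then z p - s else z p

lemma measurable_push (c : κ) : Measurable fun q : ℝ × (κ × ℕ → ℝ) => push c q.1 q.2 := by
  rw [measurable_pi_iff]
  rintro ⟨c', _ | k⟩ <;> by_cases h : c' = c <;> simp only [push, h, if_true, if_false] <;> fun_prop

lemma measurable_advance (J : Finset κ) :
    Measurable fun q : ℝ × (κ × ℕ → ℝ) => advance J q.1 q.2 := by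
  rw [measurable_pi_iff]
  rintro ⟨c', k⟩
  by_cases h : c' ∈ J ∧ k = 0 <;> simp only [advance, h] <;> simp <;> fun_prop

/-- The index shift `σ` along row `c` is injective, keeps the rates and misses only `(c, 0)`. A box
therefore pulls back under `push` to a condition on the new head times a box in the old coordinates.
-/
lemma rowLaw_map_push (r : κ → ℝ) (hr : ∀ c, 0 < r c) (c : κ) :
    ((expMeasure (r c)).prod (rowLaw r hr)).map (fun q => push c q.1 q.2) = rowLaw r hr := by
  have : ∀ p : κ × ℕ, IsProbabilityMeasure (expMeasure (r p.1)) :=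
    fun p => isProbabilityMeasure_expMeasure (hr p.1)
  have := isProbabilityMeasure_expMeasure (hr c)
  classical
  refine Measure.eq_infinitePi _ fun s t ht => ?_
  rw [Measure.map_apply (measurable_push c) (.pi s.countable_toSet fun i _ => ht i)]
  let σ : κ × ℕ → κ × ℕ := fun p => if p.1 = c then (p.1, p.2 + 1) else p
  have hσ : Function.Injective σ := by
    rintro ⟨a, k⟩ ⟨b, l⟩ h
    by_cases ha : a = c <;> by_cases hb : b = c <;> simp_all [σ]
  have hrange : ∀ p, p ∈ Set.range σ ↔ p ≠ (c, 0) := by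
    rintro ⟨a, k⟩
    constructor
    · rintro ⟨⟨b, l⟩, hb⟩ h
      by_cases hbc : b = c <;> simp_all [σ]
    · intro h
      by_cases ha : a = c
      · subst ha
        cases k with
        | zero => exact absurd rfl h
        | succ k => exact ⟨(a, k), by simp [σ]⟩
      · exact ⟨(a, k), by simp [σ, ha]⟩
  have hpush : ∀ u z q, push c u z (σ q) = z q := by
    rintro u z ⟨a, k⟩
    by_cases ha : a = c
    · simp [σ, push, ha]
    · cases k <;> simp [σ, push, ha]
  have hrate : ∀ q, r (σ q).1 = r q.1 := by
    rintro ⟨a, k⟩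
    by_cases ha : a = c <;> simp [σ, ha]
  have hpre : (fun q : ℝ × (κ × ℕ → ℝ) => push c q.1 q.2) ⁻¹' (Set.pi s t) =
      (if (c, 0) ∈ s then t (c, 0) else Set.univ) ×ˢ
        Set.pi (s.preimage σ hσ.injOn : Finset (κ × ℕ)) (fun q => t (σ q)) := by
    ext ⟨u, z⟩
    simp only [Set.mem_preimage, Set.mem_pi, Finset.mem_coe, Set.mem_prod, Finset.mem_preimage]
    constructor
    · intro h
      refine ⟨?_, fun q hq => hpush u z q ▸ h _ hq⟩
      split_ifs with h0
      · simpa [push] using h _ h0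
      · trivial
    · rintro ⟨h1, h2⟩ p hp
      by_cases hpc : p = (c, 0)
      · subst hpc
        rw [if_pos hp] at h1
        simpa [push] using h1
      · obtain ⟨q, rfl⟩ := (hrange p).2 hpc
        rw [hpush]; exact h2 q hp
  rw [hpre, Measure.prod_prod]
  have hT : rowLaw r hr (Set.pi (s.preimage σ hσ.injOn : Finset (κ × ℕ)) (fun q => t (σ q))) =
      ∏ q ∈ s.preimage σ hσ.injOn, expMeasure (r (σ q).1) (t (σ q)) := by
    unfold rowLaw
    rw [Measure.infinitePi_pi _ fun i _ => ht _]
    simp [hrate]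
  rw [hT, Finset.prod_preimage' σ s hσ.injOn fun p => expMeasure (r p.1) (t p),
    ← Finset.prod_filter_mul_prod_filter_not s (fun p => p ∈ Set.range σ), mul_comm]
  congr 1
  have : ∀ p, p ∉ Set.range σ ↔ p = (c, 0) := fun p => by rw [hrange p, not_not]
  simp only [this, Finset.filter_eq']
  split_ifs <;> simp

lemma lintegral_rowLaw_push (r : κ → ℝ) (hr : ∀ c, 0 < r c) (c : κ) {F : (κ × ℕ → ℝ) → ℝ≥0∞}
    (hF : Measurable F) :
    ∫⁻ z, F z ∂rowLaw r hr = ∫⁻ u, ∫⁻ z, F (push c u z) ∂rowLaw r hr ∂expMeasure (r c) := by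
  conv_lhs => rw [← rowLaw_map_push r hr c]
  rw [lintegral_map hF (measurable_push c),
    lintegral_prod (fun q => F (push c q.1 q.2)) (hF.comp (measurable_push c)).aemeasurable]

lemma lintegral_rowLaw_push_symm (r : κ → ℝ) (hr : ∀ c, 0 < r c) (c : κ)
    {F : (κ × ℕ → ℝ) → ℝ≥0∞} (hF : Measurable F) :
    ∫⁻ z, F z ∂rowLaw r hr = ∫⁻ z, ∫⁻ u, F (push c u z) ∂expMeasure (r c) ∂rowLaw r hr := by
  have := isProbabilityMeasure_expMeasure (hr c)
  conv_lhs => rw [← rowLaw_map_push r hr c]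
  rw [lintegral_map hF (measurable_push c),
    lintegral_prod_symm (fun q => F (push c q.1 q.2))
      (hF.comp (measurable_push c)).aemeasurable]

lemma measurable_ite_heads (J : Finset κ) {G : ℝ × (κ × ℕ → ℝ) → ℝ≥0∞} (hG : Measurable G) :
    Measurable fun q : ℝ × (κ × ℕ → ℝ) => if ∀ c ∈ J, q.1 < q.2 (c, 0) then G q else 0 := by
  refine Measurable.ite ?_ hG measurable_const
  have : {q : ℝ × (κ × ℕ → ℝ) | ∀ c ∈ J, q.1 < q.2 (c, 0)} =
      ⋂ c ∈ J, {q | q.1 < q.2 (c, 0)} := by ext; simp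
  rw [this]
  exact J.measurableSet_biInter fun c _ => measurableSet_lt measurable_fst (by fun_prop)

/-- The residual times of independent exponential clocks that are still running at time `s`. -/
lemma lintegral_rowLaw_advance (r : κ → ℝ) (hr : ∀ c, 0 < r c) {s : ℝ} (hs : 0 ≤ s)
    (J : Finset κ) : ∀ {G : (κ × ℕ → ℝ) → ℝ≥0∞}, Measurable G →
    ∫⁻ z, (if ∀ c ∈ J, s < z (c, 0) then G (advance J s z) else 0) ∂rowLaw r hr =
      (∏ c ∈ J, ENNReal.ofReal (Real.exp (-(r c * s)))) * ∫⁻ z, G z ∂rowLaw r hr := by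
  induction J using Finset.induction_on with
  | empty =>
    intro G _
    have : ∀ z, advance (∅ : Finset κ) s z = z := fun z => by funext p; simp [advance]
    simp [this]
  | insert c J hc ih =>
    intro G hG
    have hms : ∀ J : Finset κ, Measurable fun z : κ × ℕ → ℝ => advance J s z := fun J =>
      (measurable_advance J).comp (measurable_const.prodMk measurable_id)
    let H : (κ × ℕ → ℝ) → ℝ≥0∞ := fun z =>
      if ∀ c ∈ J, s < z (c, 0) then G (advance J s z) else 0
    have hH : Measurable H :=
      (measurable_ite_heads J (G := fun q => G (advance J q.1 q.2))
        (hG.comp (measurable_advance J))).comp (measurable_const.prodMk measurable_id)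
    have hadv : ∀ z, advance (insert c J) s z = advance J s (advance {c} s z) := by
      intro z; funext ⟨a, k⟩
      by_cases ha : a = c
      · subst ha; by_cases hk : k = 0 <;> simp [advance, hc, hk]
      · simp [advance, ha]
    have hhead : ∀ z, ∀ c' ∈ J, advance {c} s z (c', 0) = z (c', 0) := by
      intro z c' hc'
      have : c' ≠ c := fun h => hc (h ▸ hc')
      simp [advance, this]
    have h1 : ∀ z : κ × ℕ → ℝ, (if ∀ c' ∈ insert c J, s < z (c', 0) then
        G (advance (insert c J) s z) else 0) =
        if s < z (c, 0) then H (advance {c} s z) else 0 := by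
      intro z
      simp only [H, Finset.forall_mem_insert]
      by_cases h : s < z (c, 0)
      · simp only [h, true_and, if_true, hadv]
        refine if_congr ?_ rfl rfl
        exact forall₂_congr fun c' hc' => by rw [hhead z c' hc']
      · simp [h]
    have hpush : ∀ u z, advance {c} s (push c u z) = push c (u - s) z := by
      intro u z; funext ⟨a, k⟩
      by_cases ha : a = c
      · cases k <;> simp [advance, push, ha]
      · cases k <;> simp [advance, push, ha]
    have hp0 : ∀ u z, push c u z (c, 0) = u := fun u z => by simp [push]
    simp_rw [h1]
    -- Integrating first over the head of row `c`, with everything else fixed, leaves a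
    -- one-dimensional integral to which lack of memory applies.
    rw [lintegral_rowLaw_push_symm r hr c, Finset.prod_insert hc, mul_assoc, ← ih hG,
      lintegral_rowLaw_push_symm r hr c hH, ← lintegral_const_mul]
    · refine lintegral_congr fun z => ?_
      simp_rw [hpush, hp0]
      exact lintegral_exp_residual hs (g := fun u => H (push c u z))
        (hH.comp ((measurable_push c).comp (measurable_id.prodMk measurable_const)))
    · have := isProbabilityMeasure_expMeasure (hr c)
      exact Measurable.lintegral_prod_left (f := fun u z => H (push c u z))
        (hH.comp (measurable_push c))
    · refine Measurable.ite (measurableSet_lt measurable_const (by fun_prop))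
        (hH.comp (hms {c})) measurable_const

lemma ae_pos_rowLaw [Countable κ] (r : κ → ℝ) (hr : ∀ c, 0 < r c) :
    ∀ᵐ z ∂rowLaw r hr, ∀ p, 0 < z p := by
  have : ∀ p : κ × ℕ, IsProbabilityMeasure (expMeasure (r p.1)) :=
    fun p => isProbabilityMeasure_expMeasure (hr p.1)
  rw [ae_all_iff]
  intro p
  exact (measurePreserving_eval_infinitePi (fun p : κ × ℕ => expMeasure (r p.1)) p
    ).quasiMeasurePreserving.ae (ae_pos_expMeasure (r p.1))

/-- Written as a pushed head, the clock of row `c` is independent of the other one and has no atoms.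
-/
lemma ae_heads_ne (r : κ → ℝ) (hr : ∀ c, 0 < r c) {c c' : κ} (h : c ≠ c') :
    ∀ᵐ z ∂rowLaw r hr, z (c, 0) ≠ z (c', 0) := by
  have := isProbabilityMeasure_expMeasure (hr c)
  have hne : MeasurableSet {z : κ × ℕ → ℝ | z (c, 0) ≠ z (c', 0)} :=
    (measurableSet_eq_fun (by fun_prop) (by fun_prop)).compl
  rw [← rowLaw_map_push r hr c, ae_map_iff (measurable_push c).aemeasurable hne, ae_iff]
  have hs : MeasurableSet {q : ℝ × (κ × ℕ → ℝ) | ¬ (push c q.1 q.2 (c, 0) ≠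
      push c q.1 q.2 (c', 0))} := by
    simp only [push, if_true, if_neg h.symm, ne_eq, not_not]
    exact measurableSet_eq_fun (by fun_prop) (by fun_prop)
  rw [Measure.prod_apply_symm hs]
  simp [push, h.symm]

end Rows

end MultihopAge
end

noncomputable section

namespace MultihopAge

/-! ### Competing clocks -/

section Race

variable {κ L : Type*} [DecidableEq κ] [Fintype L] [DecidableEq L]

/-- The time of the first event when the clocks in front of the rows `sel e` compete with the
deadline `D`. -/
def raceTime (sel : L → κ) (D : ℝ) (z : κ × ℕ → ℝ) : ℝ :=
  ⨅ o : Option L, o.elim D fun e => z (sel e, 0)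

/-- The first event of the race, together with the set of the clocks that expire then. -/
def raceObs (sel : L → κ) (D : ℝ) (z : κ × ℕ → ℝ) : ℝ × Set L :=
  (raceTime sel D z, {e | z (sel e, 0) = raceTime sel D z})

open Classical in
/-- The rows after the first event of the race: the expired clocks are replaced by the next ones of
their rows, the others show their residual times. -/
def raceNext (sel : L → κ) (D : ℝ) (z : κ × ℕ → ℝ) : κ × ℕ → ℝ := fun p =>
  if ∃ e, sel e = p.1 then
    if z (p.1, 0) = raceTime sel D z then z (p.1, p.2 + 1)
    else if p.2 = 0 then z p - raceTime sel D z else z p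
  else z p

lemma raceTime_le_deadline (sel : L → κ) (D : ℝ) (z : κ × ℕ → ℝ) : raceTime sel D z ≤ D :=
  ciInf_le (Set.finite_range _).bddBelow (none : Option L)

lemma raceTime_le (sel : L → κ) (D : ℝ) (z : κ × ℕ → ℝ) (e : L) :
    raceTime sel D z ≤ z (sel e, 0) :=
  ciInf_le (Set.finite_range fun o : Option L => o.elim D fun e => z (sel e, 0)).bddBelow (some e)

lemma raceTime_eq (sel : L → κ) (D : ℝ) (z : κ × ℕ → ℝ) :
    raceTime sel D z = D ∨ ∃ e, raceTime sel D z = z (sel e, 0) := by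
  obtain ⟨o, ho⟩ := exists_eq_ciInf_of_finite (f := fun o : Option L => o.elim D fun e => z (sel e, 0))
  cases o with
  | none => exact Or.inl ho.symm
  | some e => exact Or.inr ⟨e, ho.symm⟩

lemma raceTime_pos {sel : L → κ} {D : ℝ} {z : κ × ℕ → ℝ} (hD : 0 < D)
    (hz : ∀ e, 0 < z (sel e, 0)) : 0 < raceTime sel D z := by
  rcases raceTime_eq sel D z with h | ⟨e, h⟩ <;> rw [h]
  exacts [hD, hz e]

lemma raceTime_eq_of {sel : L → κ} {D : ℝ} {z : κ × ℕ → ℝ} {t : ℝ} (hD : t ≤ D)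
    (hz : ∀ e, t ≤ z (sel e, 0)) (h : t = D ∨ ∃ e, t = z (sel e, 0)) :
    raceTime sel D z = t := by
  apply le_antisymm
  · rcases h with rfl | ⟨e, rfl⟩
    exacts [raceTime_le_deadline _ _ _, raceTime_le _ _ _ e]
  · rcases raceTime_eq sel D z with h | ⟨e, h⟩ <;> rw [h]
    exacts [hD, hz e]

lemma measurable_raceTime (sel : L → κ) :
    Measurable fun q : ℝ × (κ × ℕ → ℝ) => raceTime sel q.1 q.2 := by
  unfold raceTime
  refine Measurable.iInf fun o => ?_
  cases o <;> simp only [Option.elim] <;> fun_prop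

lemma measurable_raceObs (sel : L → κ) :
    Measurable fun q : ℝ × (κ × ℕ → ℝ) => raceObs sel q.1 q.2 := by
  refine (measurable_raceTime sel).prodMk (measurable_set_iff.2 fun e => ?_)
  exact Measurable.eq (by fun_prop) (measurable_raceTime sel)

lemma measurable_raceNext (sel : L → κ) :
    Measurable fun q : ℝ × (κ × ℕ → ℝ) => raceNext sel q.1 q.2 := by
  have h := measurable_raceTime sel
  rw [measurable_pi_iff]
  intro p
  by_cases hp : ∃ e, sel e = p.1
  · simp only [raceNext, hp, if_true]
    refine Measurable.ite (measurableSet_eq_fun (by fun_prop) h) (by fun_prop) ?_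
    by_cases hk : p.2 = 0 <;> simp only [hk, if_true, if_false] <;> fun_prop
  · simp only [raceNext, hp, if_false]; fun_prop

/-- The expectation of `f` at the first event when exponential clocks of the given rates compete
with the deadline `D`. -/
def raceMean (rate : L → ℝ) (D : ℝ) (f : ℝ × Set L → ℝ≥0∞) : ℝ≥0∞ :=
  (∑ e, ∫⁻ u, (if u ≤ D then
    (∏ e' ∈ Finset.univ.erase e, ENNReal.ofReal (Real.exp (-(rate e' * u)))) * f (u, {e}) else 0)
      ∂expMeasure (rate e)) +
    (∏ e, ENNReal.ofReal (Real.exp (-(rate e * D)))) * f (D, ∅)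

variable {sel : L → κ}

/-- Pathwise form of one outcome. Writing the winning clock as pushed in front of its row makes its
expiry undo the push, while the other competing rows merely age by `u`; this puts the integral over
the outcome in the form that `lintegral_rowLaw_advance` evaluates. -/
lemma race_of_winner (hsel : Function.Injective sel) {D u : ℝ} {z : κ × ℕ → ℝ} {e : L} (hu : u ≤ D)
    (h : ∀ e', e' ≠ e → u < z (sel e', 0)) :
    raceObs sel D (push (sel e) u z) = (u, {e}) ∧
      raceNext sel D (push (sel e) u z) = advance ((Finset.univ.erase e).image sel) u z := by
  have hne : ∀ e', e' ≠ e → push (sel e) u z (sel e', 0) = z (sel e', 0) := fun e' he' => by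
    simp [push, hsel.ne he']
  have he : push (sel e) u z (sel e, 0) = u := by simp [push]
  have ht : raceTime sel D (push (sel e) u z) = u := by
    refine raceTime_eq_of hu (fun e' => ?_) (Or.inr ⟨e, he.symm⟩)
    by_cases h' : e' = e
    · subst h'; exact he.ge
    · rw [hne e' h']; exact (h e' h').le
  constructor
  · simp only [raceObs, ht]
    congr 1
    ext e'
    by_cases h' : e' = e
    · subst h'; simp [he]
    · simp [h', hne e' h', (h e' h').ne']
  · funext ⟨c, k⟩
    simp only [raceNext, ht, advance, Finset.mem_image, Finset.mem_erase, Finset.mem_univ, and_true]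
    by_cases hc : ∃ e', sel e' = c
    · obtain ⟨e', rfl⟩ := hc
      by_cases h' : e' = e
      · subst h'
        have : ¬ ∃ a, a ≠ e' ∧ sel a = sel e' := fun ⟨a, ha, hae⟩ => ha (hsel hae)
        simp [push]
        intro a ha hae
        exact absurd (hsel hae) ha
      · have h1 : ∃ a, ¬ a = e ∧ sel a = sel e' := ⟨e', h', rfl⟩
        have h2 : ∃ a, sel a = sel e' := ⟨e', rfl⟩
        have h3 : ¬ sel e' = sel e := hsel.ne h'
        simp only [h2, if_true, hne e' h', (h e' h').ne', if_false, ne_eq, h1, true_and]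
        cases k <;> simp [push, h3]
    · have h1 : ¬ ∃ a, a ≠ e ∧ sel a = c := fun ⟨a, _, ha⟩ => hc ⟨a, ha⟩
      have h3 : ¬ c = sel e := fun h => hc ⟨e, h.symm⟩
      simp only [hc, if_false, h1, false_and]
      cases k <;> simp [push, h3]

lemma race_of_none {D : ℝ} {z : κ × ℕ → ℝ} (h : ∀ e, D < z (sel e, 0)) :
    raceObs sel D z = (D, ∅) ∧ raceNext sel D z = advance (Finset.univ.image sel) D z := by
  have ht : raceTime sel D z = D := raceTime_eq_of le_rfl (fun e => (h e).le) (Or.inl rfl)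
  constructor
  · simp only [raceObs, ht]
    congr 1
    ext e
    simp [(h e).ne']
  · funext ⟨c, k⟩
    simp only [raceNext, ht, advance, Finset.mem_image, Finset.mem_univ, true_and]
    by_cases hc : ∃ e', sel e' = c
    · obtain ⟨e', rfl⟩ := hc
      simp [(h e').ne']
    · simp [hc]

/-- The rows after the first event of a race are independent of this event and distributed like the
rows before. The law of the event depends on the rates only. -/
lemma lintegral_race (hsel : Function.Injective sel) (r : κ → ℝ) (hr : ∀ c, 0 < r c)
    {D : ℝ} (hD : 0 ≤ D) {F : (ℝ × Set L) × (κ × ℕ → ℝ) → ℝ≥0∞} (hF : Measurable F) :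
    ∫⁻ z, F (raceObs sel D z, raceNext sel D z) ∂rowLaw r hr =
      raceMean (fun e => r (sel e)) D fun o => ∫⁻ z, F (o, z) ∂rowLaw r hr := by
  let J : L → Finset κ := fun e => (Finset.univ.erase e).image sel
  let A : L → (κ × ℕ → ℝ) → ℝ≥0∞ := fun e z =>
    if z (sel e, 0) ≤ D ∧ ∀ e', e' ≠ e → z (sel e, 0) < z (sel e', 0) then
      F (raceObs sel D z, raceNext sel D z) else 0
  let B : (κ × ℕ → ℝ) → ℝ≥0∞ := fun z =>
    if ∀ e, D < z (sel e, 0) then F (raceObs sel D z, raceNext sel D z) else 0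
  have hDz : Measurable fun z : κ × ℕ → ℝ => (D, z) := by fun_prop
  have hR : Measurable fun z : κ × ℕ → ℝ => F (raceObs sel D z, raceNext sel D z) :=
    hF.comp (((measurable_raceObs sel).comp hDz).prodMk ((measurable_raceNext sel).comp hDz))
  have hA : ∀ e, Measurable (A e) := fun e => by
    have h1 : MeasurableSet {z : κ × ℕ → ℝ | z (sel e, 0) ≤ D} :=
      measurableSet_le (by fun_prop) measurable_const
    have h2 : MeasurableSet {z : κ × ℕ → ℝ | ∀ e', e' ≠ e → z (sel e, 0) < z (sel e', 0)} := by
      have : {z : κ × ℕ → ℝ | ∀ e', e' ≠ e → z (sel e, 0) < z (sel e', 0)} =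
        ⋂ e', ⋂ (_ : e' ≠ e), {z | z (sel e, 0) < z (sel e', 0)} := by ext; simp
      rw [this]
      exact .iInter fun e' => .iInter fun _ => measurableSet_lt (by fun_prop) (by fun_prop)
    exact Measurable.ite (h1.inter h2) hR measurable_const
  have hB : Measurable B := by
    refine Measurable.ite ?_ hR measurable_const
    have : {z : κ × ℕ → ℝ | ∀ e, D < z (sel e, 0)} = ⋂ e, {z | D < z (sel e, 0)} := by ext; simp
    rw [this]
    exact .iInter fun e => measurableSet_lt (by fun_prop) (by fun_prop)
  -- Ties between clocks are null. Hence almost surely exactly one of these events occurs: a unique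
  -- clock wins no later than `D`, or all clocks outlast `D`.
  have hsplit : ∀ᵐ z ∂rowLaw r hr,
      F (raceObs sel D z, raceNext sel D z) = (∑ e, A e z) + B z := by
    have hne : ∀ᵐ z ∂rowLaw r hr, ∀ e e' : L, e ≠ e' → z (sel e, 0) ≠ z (sel e', 0) := by
      simp only [ae_all_iff]
      exact fun e e' h => ae_heads_ne r hr (hsel.ne h)
    filter_upwards [hne] with z hz
    by_cases hall : ∀ e, D < z (sel e, 0)
    · have h0 : ∀ e, A e z = 0 := fun e => if_neg fun h => absurd h.1 (hall e).not_ge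
      simp [h0, B, hall]
    · push Not at hall
      obtain ⟨e0, he0⟩ := hall
      obtain ⟨e, -, he⟩ := Finset.exists_min_image Finset.univ (fun e => z (sel e, 0))
        ⟨e0, Finset.mem_univ _⟩
      have heD : z (sel e, 0) ≤ D := (he e0 (Finset.mem_univ _)).trans he0
      have hB0 : B z = 0 := if_neg fun h => absurd heD (h e).not_ge
      have hlt : ∀ e', e' ≠ e → z (sel e, 0) < z (sel e', 0) := fun e' h =>
        (he e' (Finset.mem_univ _)).lt_of_ne (hz e e' h.symm)
      have hA0 : ∀ e', e' ≠ e → A e' z = 0 := fun e' h => if_neg fun h' =>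
        absurd (h'.2 e h.symm) (hlt e' h).not_gt
      rw [hB0, add_zero, Finset.sum_eq_single e (fun e' _ h => hA0 e' h) (by simp)]
      exact (if_pos ⟨heD, hlt⟩).symm
  -- Fix the winning time `u`. The product is the probability that the other clocks outlast `u`, and
  -- their residual times then have the law of new clocks.
  have hAint : ∀ e, ∫⁻ z, A e z ∂rowLaw r hr = ∫⁻ u, (if u ≤ D then
      (∏ e' ∈ Finset.univ.erase e, ENNReal.ofReal (Real.exp (-(r (sel e') * u)))) *
        ∫⁻ z, F ((u, {e}), z) ∂rowLaw r hr else 0) ∂expMeasure (r (sel e)) := by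
    intro e
    rw [lintegral_rowLaw_push r hr (sel e) (hA e)]
    refine lintegral_congr_ae ?_
    filter_upwards [ae_pos_expMeasure (r (sel e))] with u hu
    have h1 : ∀ z : κ × ℕ → ℝ, A e (push (sel e) u z) = if u ≤ D then
        (if ∀ c ∈ J e, u < z (c, 0) then F ((u, {e}), advance (J e) u z) else 0) else 0 := by
      intro z
      have hne : ∀ e', e' ≠ e → push (sel e) u z (sel e', 0) = z (sel e', 0) := fun e' he' => by
        simp [push, hsel.ne he']
      have he : push (sel e) u z (sel e, 0) = u := by simp [push]
      have hJ : (∀ c ∈ J e, u < z (c, 0)) ↔ ∀ e', e' ≠ e → u < z (sel e', 0) := by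
        simp [J]
      by_cases huD : u ≤ D
      · by_cases hall : ∀ e', e' ≠ e → u < z (sel e', 0)
        · obtain ⟨h2, h3⟩ := race_of_winner hsel (z := z) huD hall
          have h4 : ∀ e', e' ≠ e →
              push (sel e) u z (sel e, 0) < push (sel e) u z (sel e', 0) := fun e' h' => by
            rw [he, hne e' h']; exact hall e' h'
          rw [if_pos huD, if_pos (hJ.2 hall)]
          simp only [A]
          rw [if_pos ⟨he.trans_le huD, h4⟩, h2, h3]
        · rw [if_pos huD, if_neg (mt hJ.1 hall)]
          refine if_neg fun h => hall fun e' h' => ?_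
          have := h.2 e' h'
          rwa [he, hne e' h'] at this
      · rw [if_neg huD]
        exact if_neg fun h => huD (he ▸ h.1)
    simp_rw [h1]
    by_cases huD : u ≤ D
    · simp only [huD, if_true]
      rw [lintegral_rowLaw_advance r hr hu.le (J e) (G := fun z => F ((u, {e}), z)) (by fun_prop),
        Finset.prod_image fun a _ b _ h => hsel h]
    · simp [huD]
  have hBint : ∫⁻ z, B z ∂rowLaw r hr =
      (∏ e, ENNReal.ofReal (Real.exp (-(r (sel e) * D)))) * ∫⁻ z, F ((D, ∅), z) ∂rowLaw r hr := by
    obtain ⟨J', hJ'⟩ : ∃ J' : Finset κ, J' = Finset.univ.image sel := ⟨_, rfl⟩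
    have h1 : ∀ z : κ × ℕ → ℝ, B z = if ∀ c ∈ J', D < z (c, 0) then
        F ((D, ∅), advance J' D z) else 0 := by
      intro z
      by_cases h : ∀ e, D < z (sel e, 0)
      · obtain ⟨h2, h3⟩ := race_of_none h
        simp [B, h, h2, h3, hJ']
      · simp [B, h, hJ']
    simp_rw [h1]
    rw [lintegral_rowLaw_advance r hr hD _ (G := fun z => F ((D, ∅), z)) (by fun_prop), hJ',
      Finset.prod_image fun a _ b _ h => hsel h]
  rw [lintegral_congr_ae hsplit, lintegral_add_right _ hB, lintegral_finsetSum _ fun e _ => hA e,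
    hBint, raceMean]
  simp_rw [hAint]

end Race

end MultihopAge
end

noncomputable section

namespace MultihopAge

/-! ### Controlled chains driven by clocks -/

section Chain

variable {L : Type*} [Fintype L] [DecidableEq L]

/-- Two rows of clocks for every link. -/
abbrev Clocks (L : Type*) := (L × Bool) × ℕ → ℝ

/-- All clocks are independent and exponential with the rates of the links. -/
def clockLaw (rate : L → ℝ) (hrate : ∀ e, 0 < rate e) : Measure (Clocks L) :=
  rowLaw (fun c : L × Bool => rate c.1) fun c => hrate c.1

instance (rate : L → ℝ) (hrate : ∀ e, 0 < rate e) : IsProbabilityMeasure (clockLaw rate hrate) := by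
  unfold clockLaw; infer_instance

open Classical in
/-- Remove the first clocks of the `true` rows of the links in `S`. -/
def dropRows (S : Set L) (z : Clocks L) : Clocks L := fun p =>
  if p.1.2 = true ∧ p.1.1 ∈ S then z (p.1, p.2 + 1) else z p

lemma measurable_dropRows (S : Set L) : Measurable (dropRows S) := by
  rw [measurable_pi_iff]
  intro p
  unfold dropRows
  split_ifs <;> fun_prop

/-- A shift of some rows is an injective, rate-preserving change of indices. Thus a discard chosen
from the outcome of a race, which is independent of the remaining rows, leaves their law unchanged.
-/
lemma clockLaw_map_dropRows (rate : L → ℝ) (hrate : ∀ e, 0 < rate e) (S : Set L) :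
    (clockLaw rate hrate).map (dropRows S) = clockLaw rate hrate := by
  classical
  have : dropRows S = fun (z : Clocks L) p =>
      z (if p.1.2 = true ∧ p.1.1 ∈ S then (p.1, p.2 + 1) else p) := by
    funext z p
    simp only [dropRows]
    split_ifs <;> rfl
  rw [this]
  refine rowLaw_map_comp_injective _ _ _ _ ?_ ?_
  · rintro ⟨a, k⟩ ⟨b, l⟩ h
    beta_reduce at h
    have hab : a = b := by
      have := congrArg Prod.fst h
      split_ifs at this <;> exact this
    subst hab
    by_cases ha : a.2 = true ∧ a.1 ∈ S
    · rw [if_pos ha, if_pos ha] at h; simpa using h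
    · rwa [if_neg ha, if_neg ha] at h
  · rintro ⟨a, k⟩
    by_cases ha : a.2 = true ∧ a.1 ∈ S <;> simp [ha]

variable {Q : Type*} [MeasurableSpace Q]

/-- A control selects in every state the row of each link that takes part in the race, and the rows
whose first clock is discarded after the race. -/
structure Control (Q L : Type*) [MeasurableSpace Q] where
  sel : Q → L → Bool
  disc : Q → ℝ × Set L → Set L
  measurable_sel : Measurable sel
  measurable_disc : Measurable fun p : Q × (ℝ × Set L) => disc p.1 p.2

/-- The dynamics of a controlled chain: the deadline of the race in a state, and the state after
the race. -/
structure Dynamics (Q L : Type*) [MeasurableSpace Q] where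
  deadline : Q → ℝ
  next : Q → ℝ × Set L → Q
  deadline_nonneg : ∀ q, 0 ≤ deadline q
  measurable_deadline : Measurable deadline
  measurable_next : Measurable fun p : Q × (ℝ × Set L) => next p.1 p.2

namespace Dynamics

variable (d : Dynamics Q L) (c : Control Q L)

/-- The outcome of the race in the state `s.1`. -/
def obs (s : Q × Clocks L) : ℝ × Set L :=
  raceObs (fun e => (e, c.sel s.1 e)) (d.deadline s.1) s.2

/-- One step of the chain. -/
def step (s : Q × Clocks L) : Q × Clocks L :=
  (d.next s.1 (d.obs c s), dropRows (c.disc s.1 (d.obs c s))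
    (raceNext (fun e => (e, c.sel s.1 e)) (d.deadline s.1) s.2))

/-- The chain started in the state `q` with clocks `z`. -/
def chain (q : Q) (z : Clocks L) : ℕ → Q × Clocks L
  | 0 => (q, z)
  | n + 1 => d.step c (chain q z n)

/-- The sequence of the states of the chain. -/
def path (q : Q) (z : Clocks L) (n : ℕ) : Q := (d.chain c q z n).1

lemma measurable_obs : Measurable (d.obs c) := by
  have h : Measurable fun p : (L → Bool) × (ℝ × Clocks L) =>
      -- The selection ranges over a finite type, so joint measurability follows from measurability
      -- for each fixed selection.
      raceObs (fun e => (e, p.1 e)) p.2.1 p.2.2 :=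
    measurable_from_prod_countable_right fun b => measurable_raceObs fun e => (e, b e)
  exact h.comp ((c.measurable_sel.comp measurable_fst).prodMk
    ((d.measurable_deadline.comp measurable_fst).prodMk measurable_snd))

lemma measurable_step : Measurable (d.step c) := by
  have h : Measurable fun p : (L → Bool) × (ℝ × Clocks L) =>
      raceNext (fun e => (e, p.1 e)) p.2.1 p.2.2 :=
    measurable_from_prod_countable_right fun b => measurable_raceNext fun e => (e, b e)
  have h2 : Measurable fun p : Set L × Clocks L => dropRows p.1 p.2 :=
    measurable_from_prod_countable_right fun S => measurable_dropRows S
  have ho := d.measurable_obs c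
  refine (d.measurable_next.comp (measurable_fst.prodMk ho)).prodMk (h2.comp
    ((c.measurable_disc.comp (measurable_fst.prodMk ho)).prodMk ?_))
  exact h.comp ((c.measurable_sel.comp measurable_fst).prodMk
    ((d.measurable_deadline.comp measurable_fst).prodMk measurable_snd))

lemma measurable_chain (q : Q) (n : ℕ) : Measurable fun z => d.chain c q z n := by
  induction n with
  | zero => exact measurable_const.prodMk measurable_id
  | succ n ih => exact (d.measurable_step c).comp ih

lemma measurable_path (q : Q) : Measurable (d.path c q) :=
  measurable_pi_iff.2 fun n => measurable_fst.comp (d.measurable_chain c q n)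

/-- The path up to time `n`, continued by a constant. -/
def stopped (q : Q) (n : ℕ) (z : Clocks L) (k : ℕ) : Q := d.path c q z (min k n)

/-- The sequence that agrees with `p` up to time `n` and has the value `q` afterwards. -/
def extend (n : ℕ) (p : ℕ → Q) (q : Q) (k : ℕ) : Q := if k ≤ n then p k else q

lemma measurable_extend (n : ℕ) : Measurable fun x : (ℕ → Q) × Q => extend n x.1 x.2 := by
  rw [measurable_pi_iff]
  intro k
  by_cases h : k ≤ n <;> simp only [extend, h, if_true, if_false] <;> fun_prop

lemma measurable_stopped (q : Q) (n : ℕ) : Measurable (d.stopped c q n) :=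
  measurable_pi_iff.2 fun _ => (measurable_pi_apply _).comp (d.measurable_path c q)

lemma stopped_succ (q : Q) (n : ℕ) (z : Clocks L) :
    d.stopped c q (n + 1) z = extend n (d.stopped c q n z)
      (d.next (d.stopped c q n z n) (d.obs c (d.stopped c q n z n, (d.chain c q z n).2))) := by
  refine funext fun k => ?_
  by_cases h : k ≤ n
  · simp [stopped, extend, h, Nat.le_succ_of_le h]
  · have : n + 1 ≤ k := by omega
    simp [stopped, extend, h, path, this, chain, step]

/-- The law of the chain after one more step, in terms of the rates only. -/
lemma lintegral_extend (rate : L → ℝ) (hrate : ∀ e, 0 < rate e) (n : ℕ)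
    {F : (ℕ → Q) × Clocks L → ℝ≥0∞} (hF : Measurable F) (p : ℕ → Q) :
    ∫⁻ z, F (extend n p (d.next (p n) (d.obs c (p n, z))), (d.step c (p n, z)).2)
        ∂clockLaw rate hrate =
      raceMean rate (d.deadline (p n)) fun o =>
        ∫⁻ z, F (extend n p (d.next (p n) o), z) ∂clockLaw rate hrate := by
  have hnext : Measurable fun o => extend n p (d.next (p n) o) :=
    (measurable_extend n).comp (measurable_const.prodMk
      (d.measurable_next.comp (measurable_const.prodMk measurable_id)))
  have h2 : Measurable fun p : Set L × Clocks L => dropRows p.1 p.2 :=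
    measurable_from_prod_countable_right fun S => measurable_dropRows S
  have hdisc : Measurable fun o => c.disc (p n) o :=
    c.measurable_disc.comp (measurable_const.prodMk measurable_id)
  have hG : Measurable fun x : (ℝ × Set L) × Clocks L =>
      F (extend n p (d.next (p n) x.1), dropRows (c.disc (p n) x.1) x.2) :=
    hF.comp ((hnext.comp measurable_fst).prodMk
      (h2.comp ((hdisc.comp measurable_fst).prodMk measurable_snd)))
  have hinj : Function.Injective fun e : L => (e, c.sel (p n) e) := fun a b h => by
    simpa using (Prod.ext_iff.1 h).1
  refine (lintegral_race hinj (fun c : L × Bool => rate c.1) (fun c => hrate c.1)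
    (d.deadline_nonneg (p n)) hG).trans ?_
  congr 1
  funext o
  conv_rhs => rw [← clockLaw_map_dropRows rate hrate (c.disc (p n) o)]
  rw [lintegral_map (f := fun z => F (extend n p (d.next (p n) o), z))
    (hF.comp (measurable_const.prodMk measurable_id)) (measurable_dropRows _)]
  rfl

/-- The order of the quantifiers matters: `lam` is chosen before the control. Stating also that the
clocks in the current state are independent of the past, with their original law, is what lets the
induction apply `lintegral_extend` with the past held fixed. -/
lemma exists_law_stopped (rate : L → ℝ) (hrate : ∀ e, 0 < rate e) (q : Q) (n : ℕ) :
    ∃ lam : Measure (ℕ → Q), IsProbabilityMeasure lam ∧ ∀ c : Control Q L,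
      (clockLaw rate hrate).map (fun z => (d.stopped c q n z, (d.chain c q z n).2)) =
        lam.prod (clockLaw rate hrate) := by
  induction n with
  | zero =>
    refine ⟨Measure.dirac fun _ => q, inferInstance, fun c => ?_⟩
    rw [Measure.dirac_prod]
    congr 1
    funext z
    refine Prod.ext ?_ rfl
    funext k
    simp [stopped, path, chain]
  | succ n ih =>
    obtain ⟨lam, hlam, ih⟩ := ih
    have hm : ∀ (c : Control Q L) n, Measurable fun z =>
        (d.stopped c q n z, (d.chain c q z n).2) := fun c n =>
      (d.measurable_stopped c q n).prodMk (measurable_snd.comp (d.measurable_chain c q n))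
    have key : ∀ (c : Control Q L) {F : (ℕ → Q) × Clocks L → ℝ≥0∞}, Measurable F →
        ∫⁻ z, F (d.stopped c q (n + 1) z, (d.chain c q z (n + 1)).2) ∂clockLaw rate hrate =
        ∫⁻ p, raceMean rate (d.deadline (p n)) (fun o =>
          ∫⁻ z, F (extend n p (d.next (p n) o), z) ∂clockLaw rate hrate) ∂lam := by
      intro c F hF
      let G : (ℕ → Q) × Clocks L → ℝ≥0∞ := fun x =>
        F (extend n x.1 (d.next (x.1 n) (d.obs c (x.1 n, x.2))), (d.step c (x.1 n, x.2)).2)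
      have hpn : Measurable fun x : (ℕ → Q) × Clocks L => (x.1 n, x.2) := by fun_prop
      have hG : Measurable G := by
        refine hF.comp (Measurable.prodMk ?_ (measurable_snd.comp ((d.measurable_step c).comp hpn)))
        refine (measurable_extend n).comp (measurable_fst.prodMk ?_)
        exact d.measurable_next.comp ((by fun_prop : Measurable fun x : (ℕ → Q) × Clocks L =>
          x.1 n).prodMk ((d.measurable_obs c).comp hpn))
      have h1 : ∀ z, F (d.stopped c q (n + 1) z, (d.chain c q z (n + 1)).2) =
          G (d.stopped c q n z, (d.chain c q z n).2) := by
        intro z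
        have : (d.stopped c q n z n, (d.chain c q z n).2) = d.chain c q z n := by
          simp [stopped, path]
        simp only [G]
        rw [stopped_succ, this, chain]
      simp_rw [h1]
      rw [← lintegral_map hG (hm c n), ih c, lintegral_prod _ hG.aemeasurable]
      exact lintegral_congr fun p => d.lintegral_extend c rate hrate n hF p
    -- Any reference control would do for defining the law, because the right side of `key` does not
    -- involve the control.
    let c0 : Control Q L := ⟨fun _ _ => true, fun _ _ => ∅, measurable_const, measurable_const⟩
    let lam' := (clockLaw rate hrate).map (d.stopped c0 q (n + 1))
    have hlam' : IsProbabilityMeasure lam' :=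
      Measure.isProbabilityMeasure_map (d.measurable_stopped c0 q (n + 1)).aemeasurable
    refine ⟨lam', hlam', fun c => Measure.ext_of_lintegral _ fun F hF => ?_⟩
    have hF' : Measurable fun p => ∫⁻ z, F (p, z) ∂clockLaw rate hrate := hF.lintegral_prod_right'
    rw [lintegral_map hF (hm c _), key c hF, lintegral_prod _ hF.aemeasurable,
      lintegral_map hF' (d.measurable_stopped c0 q (n + 1))]
    rw [key c0 (F := fun x => ∫⁻ z, F (x.1, z) ∂clockLaw rate hrate) (hF'.comp measurable_fst)]
    simp

/-- The law of the path does not depend on the control. -/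
theorem map_path_eq (rate : L → ℝ) (hrate : ∀ e, 0 < rate e) (q : Q) (c c' : Control Q L) :
    (clockLaw rate hrate).map (d.path c q) = (clockLaw rate hrate).map (d.path c' q) := by
  have hst : ∀ n, (clockLaw rate hrate).map (d.stopped c q n) =
      (clockLaw rate hrate).map (d.stopped c' q n) := by
    intro n
    obtain ⟨lam, -, h⟩ := d.exists_law_stopped rate hrate q n
    have hm : ∀ c : Control Q L, Measurable fun z => (d.stopped c q n z, (d.chain c q z n).2) :=
      fun c => (d.measurable_stopped c q n).prodMk (measurable_snd.comp (d.measurable_chain c q n))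
    have := congrArg (Measure.map Prod.fst) ((h c).trans (h c').symm)
    rwa [Measure.map_map measurable_fst (hm c), Measure.map_map measurable_fst (hm c')] at this
  have hp : ∀ c : Control Q L, IsProbabilityMeasure ((clockLaw rate hrate).map (d.path c q)) :=
    fun c => Measure.isProbabilityMeasure_map (d.measurable_path c q).aemeasurable
  have := hp c
  have := hp c'
  -- Finitely many coordinates of the path are coordinates of a path stopped late enough.
  refine IsProjectiveLimit.unique (P := fun I : Finset ℕ =>
    ((clockLaw rate hrate).map (d.path c q)).map I.restrict) (fun I => rfl) fun I => ?_
  have hr : ∀ c : Control Q L, ((clockLaw rate hrate).map (d.path c q)).map I.restrict =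
      ((clockLaw rate hrate).map (d.stopped c q (I.sup id))).map I.restrict := by
    intro c
    rw [Measure.map_map (by fun_prop) (d.measurable_path c q),
      Measure.map_map (by fun_prop) (d.measurable_stopped c q _)]
    congr 1
    funext z i
    have : i.1 ≤ I.sup id := Finset.le_sup (f := id) i.2
    simp [stopped, this]
  exact (hr c').trans ((congrArg _ (hst _).symm).trans (hr c).symm)

end Dynamics

end Chain

end MultihopAge
end

noncomputable section

namespace MultihopAge

/-! ### Divergence of the clocks -/

/-- The sums of the clocks in all rows diverge. -/
def RowsDiverge {κ : Type*} (z : κ × ℕ → ℝ) : Prop :=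
  ∀ c (C : ℝ), ∃ K, C < ∑ k ∈ Finset.range K, z (c, k)

lemma expMeasure_Iic_one_lt {r : ℝ} (hr : 0 < r) : expMeasure r (Set.Iic 1) < 1 := by
  have := isProbabilityMeasure_expMeasure hr
  have h := lintegral_exp_residual (r := r) zero_le_one (g := fun _ => 1) measurable_const
  have h1 : ∫⁻ u, (if 1 < u then 1 else 0) ∂expMeasure r = expMeasure r (Set.Ioi 1) := by
    rw [← lintegral_indicator_one measurableSet_Ioi]
    congr 1
  rw [h1] at h
  simp only [lintegral_const, measure_univ, mul_one] at h
  rw [← Set.compl_Ioi, prob_compl_eq_one_sub measurableSet_Ioi, h]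
  refine ENNReal.sub_lt_self ENNReal.one_ne_top one_ne_zero ?_
  simp [Real.exp_pos]

/-- A run of `n` clocks that are all at most `1` has probability `p ^ n` with `p < 1`. So almost
surely clocks longer than `1` occur in each row beyond every index, and as all clocks are positive
the sums grow without bound. -/
lemma ae_rowsDiverge {κ : Type*} [Countable κ] (r : κ → ℝ) (hr : ∀ c, 0 < r c) :
    ∀ᵐ z ∂rowLaw r hr, RowsDiverge z := by
  classical
  have hprob : ∀ p : κ × ℕ, IsProbabilityMeasure (expMeasure (r p.1)) :=
    fun p => isProbabilityMeasure_expMeasure (hr p.1)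
  have key : ∀ c K, ∀ᵐ z ∂rowLaw r hr, ∃ k, 1 < z (c, K + k) := by
    intro c K
    rw [ae_iff]
    have hle : ∀ n : ℕ, rowLaw r hr {z | ¬ ∃ k, 1 < z (c, K + k)} ≤
        expMeasure (r c) (Set.Iic 1) ^ n := by
      intro n
      let s : Finset (κ × ℕ) := (Finset.range n).image fun k => (c, K + k)
      calc rowLaw r hr {z | ¬ ∃ k, 1 < z (c, K + k)} ≤
          rowLaw r hr (Set.pi s fun _ => Set.Iic 1) := by
            refine measure_mono fun z hz p hp => ?_
            obtain ⟨k, -, rfl⟩ := Finset.mem_image.1 hp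
            exact not_lt.1 fun h => hz ⟨k, h⟩
        _ = expMeasure (r c) (Set.Iic 1) ^ n := by
            unfold rowLaw
            rw [Measure.infinitePi_pi _ fun _ _ => measurableSet_Iic, Finset.prod_image]
            · simp
            · intro a _ b _ h
              simpa using h
    exact le_antisymm (ge_of_tendsto' (ENNReal.tendsto_pow_atTop_nhds_zero_of_lt_one
      (expMeasure_Iic_one_lt (hr c))) hle) zero_le
  have hall : ∀ᵐ z ∂rowLaw r hr, ∀ c K, ∃ k, 1 < z (c, K + k) := by
    simp only [ae_all_iff]; exact key
  filter_upwards [hall, ae_pos_rowLaw r hr] with z hz hpos c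
  have hn : ∀ n : ℕ, ∃ K, (n : ℝ) ≤ ∑ k ∈ Finset.range K, z (c, k) := by
    intro n
    induction n with
    | zero => exact ⟨0, by simp⟩
    | succ n ih =>
      obtain ⟨K, hK⟩ := ih
      obtain ⟨k, hk⟩ := hz c K
      refine ⟨K + k + 1, ?_⟩
      rw [Finset.sum_range_succ]
      have : ∑ k ∈ Finset.range K, z (c, k) ≤ ∑ k ∈ Finset.range (K + k), z (c, k) :=
        Finset.sum_le_sum_of_subset_of_nonneg (by simp) fun i _ _ => (hpos _).le
      push_cast
      linarith
  intro C
  obtain ⟨n, hC⟩ := exists_nat_gt C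
  obtain ⟨K, hK⟩ := hn n
  exact ⟨K, hC.trans_le hK⟩

/-! ### Gluing -/

/-- Two random elements of standard Borel spaces can be coupled in such a way that two of their
functions with the same law agree. -/
lemma exists_coupling {α β W : Type*} [MeasurableSpace α] [StandardBorelSpace α] [Nonempty α]
    [MeasurableSpace β] [StandardBorelSpace β] [Nonempty β] [MeasurableSpace W] [MeasurableEq W]
    (μ : Measure α) [IsProbabilityMeasure μ] (ν : Measure β) [IsProbabilityMeasure ν]
    {p : α → W} (hp : Measurable p) {q : β → W} (hq : Measurable q) (h : μ.map p = ν.map q) :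
    ∃ γ : Measure (α × β), IsProbabilityMeasure γ ∧ γ.map Prod.fst = μ ∧ γ.map Prod.snd = ν ∧
      ∀ᵐ x ∂γ, p x.1 = q x.2 := by
  have : IsProbabilityMeasure (μ.map p) := Measure.isProbabilityMeasure_map hp.aemeasurable
  let κ₁ := condDistrib id p μ
  let κ₂ := condDistrib id q ν
  have h1 : (μ.map p) ⊗ₘ κ₁ = μ.map fun a => (p a, a) := compProd_map_condDistrib aemeasurable_id
  have h2 : (μ.map p) ⊗ₘ κ₂ = ν.map fun b => (q b, b) := by
    rw [h]; exact compProd_map_condDistrib aemeasurable_id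
  -- Draw the common value first and then, independently given it, the two elements from their
  -- conditional laws.
  let G : Measure (W × (α × β)) := (μ.map p) ⊗ₘ (κ₁ ×ₖ κ₂)
  have g1 : G.map (Prod.map id Prod.fst) = μ.map fun a => (p a, a) := by
    rw [← h1, ← Measure.compProd_map measurable_fst, ← Kernel.fst_eq, Kernel.fst_prod]
  have g2 : G.map (Prod.map id Prod.snd) = ν.map fun b => (q b, b) := by
    rw [← h2, ← Measure.compProd_map measurable_snd, ← Kernel.snd_eq, Kernel.snd_prod]
  have mpa : Measurable fun a => (p a, a) := hp.prodMk measurable_id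
  have mqb : Measurable fun b => (q b, b) := hq.prodMk measurable_id
  refine ⟨G.map Prod.snd, Measure.isProbabilityMeasure_map (by fun_prop), ?_, ?_, ?_⟩
  · rw [Measure.map_map measurable_fst measurable_snd]
    have := congrArg (Measure.map Prod.snd) g1
    rw [Measure.map_map measurable_snd (by fun_prop), Measure.map_map measurable_snd mpa] at this
    exact this.trans Measure.map_id
  · rw [Measure.map_map measurable_snd measurable_snd]
    have := congrArg (Measure.map Prod.snd) g2
    rw [Measure.map_map measurable_snd (by fun_prop), Measure.map_map measurable_snd mqb] at this
    exact this.trans Measure.map_id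
  · have e1 : ∀ᵐ x ∂G, p x.2.1 = x.1 := by
      have : ∀ᵐ y ∂G.map (Prod.map id Prod.fst), p y.2 = y.1 := by
        rw [g1, ae_map_iff mpa.aemeasurable
          (measurableSet_eq_fun (f := fun y => p y.2) (by fun_prop) measurable_fst)]
        simp
      exact ae_of_ae_map (by fun_prop) this
    have e2 : ∀ᵐ x ∂G, q x.2.2 = x.1 := by
      have : ∀ᵐ y ∂G.map (Prod.map id Prod.snd), q y.2 = y.1 := by
        rw [g2, ae_map_iff mqb.aemeasurable
          (measurableSet_eq_fun (f := fun y => q y.2) (by fun_prop) measurable_fst)]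
        simp
      exact ae_of_ae_map (by fun_prop) this
    rw [ae_map_iff measurable_snd.aemeasurable
      (measurableSet_eq_fun (f := fun x : α × β => p x.1) (g := fun x : α × β => q x.2) (by fun_prop)
        (by fun_prop))]
    filter_upwards [e1, e2] with x hx1 hx2
    rw [hx1, hx2]

/-- Measurable diagonals are what `exists_coupling` requires of the space of paths, a space of
sequences of pairs of a time and a list of observations. This instance and the following ones build
them up. -/
instance measurableEq_pi {ι : Type*} [Countable ι] {X : ι → Type*} [∀ i, MeasurableSpace (X i)]
    [∀ i, MeasurableEq (X i)] : MeasurableEq (∀ i, X i) := by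
  constructor
  have : Set.diagonal (∀ i, X i) = ⋂ i, {x | x.1 i = x.2 i} := by
    ext x; simp [funext_iff]
  rw [this]
  exact .iInter fun i => measurableSet_eq_fun (by fun_prop) (by fun_prop)

instance measurableEq_prod {X Y : Type*} [MeasurableSpace X] [MeasurableSpace Y] [MeasurableEq X]
    [MeasurableEq Y] : MeasurableEq (X × Y) := by
  constructor
  have : Set.diagonal (X × Y) = {x | x.1.1 = x.2.1} ∩ {x | x.1.2 = x.2.2} := by
    ext x; simp [Prod.ext_iff]
  rw [this]
  exact (measurableSet_eq_fun (by fun_prop) (by fun_prop)).inter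
    (measurableSet_eq_fun (by fun_prop) (by fun_prop))

lemma measurableEq_of_injective {X Y : Type*} [MeasurableSpace X] [MeasurableSpace Y]
    [MeasurableEq Y] {f : X → Y} (hf : Measurable f) (hi : Function.Injective f) :
    MeasurableEq X := by
  constructor
  have : Set.diagonal X = {x | f x.1 = f x.2} := by ext x; simp [hi.eq_iff]
  rw [this]
  exact measurableSet_eq_fun (by fun_prop) (by fun_prop)

/-! ### Measurability of functions of lists -/

/-- The measurable structure of `List α` that it has as the disjoint union of the finite powers
of `α`. -/
instance listMeasurableSpace {α : Type*} [MeasurableSpace α] [Inhabited α] :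
    MeasurableSpace (List α) :=
  MeasurableSpace.comap (fun l => (l.length, fun i => l.getD i default)) inferInstance

section ListMeasurable

variable {α β γ : Type*} [MeasurableSpace α] [Inhabited α] [MeasurableSpace β] [MeasurableSpace γ]

lemma measurable_length_getD :
    Measurable fun l : List α => (l.length, fun i => l.getD i default) :=
  comap_measurable _

lemma measurable_list_length : Measurable (List.length : List α → ℕ) :=
  measurable_fst.comp measurable_length_getD

lemma measurable_list_getD (i : ℕ) : Measurable fun l : List α => l.getD i default :=
  (measurable_pi_apply i).comp (measurable_snd.comp measurable_length_getD)

lemma measurable_to_list {f : β → List α} (h : Measurable fun b => (f b).length)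
    (h' : ∀ i, Measurable fun b => (f b).getD i default) : Measurable f :=
  measurable_comap_iff.2 (h.prodMk (measurable_pi_iff.2 h'))

lemma measurable_list_cons : Measurable fun p : α × List α => p.1 :: p.2 := by
  refine measurable_to_list ?_ fun i => ?_
  · simpa using (measurable_list_length.comp measurable_snd).add_const 1
  · cases i with
    | zero => simpa using measurable_fst
    | succ i =>
      simp only [List.getD_cons_succ]
      exact (measurable_list_getD i).comp measurable_snd

lemma measurable_list_ofFn (n : ℕ) : Measurable (List.ofFn : (Fin n → α) → List α) := by
  refine measurable_to_list (by simp) fun i => ?_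
  by_cases h : i < n
  · simpa [List.getD_eq_getElem?_getD, h] using measurable_pi_apply (⟨i, h⟩ : Fin n)
  · simp [List.getD_eq_getElem?_getD, h]

/-- The lengths cut the space of lists into countably many measurable pieces, each a finite power.
This is the bridge from the measurability requirements in `CausalPolicy`, which are stated length by
length. -/
lemma measurable_prod_list {f : γ × List α → β}
    (h : ∀ n, Measurable fun q : γ × (Fin n → α) => f (q.1, List.ofFn q.2)) : Measurable f := by
  intro B hB
  have : f ⁻¹' B = ⋃ n, {p : γ × List α | p.2.length = n} ∩
      (fun p : γ × List α => f (p.1, List.ofFn fun i : Fin n => p.2.getD i default)) ⁻¹' B := by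
    ext ⟨c, l⟩
    simp
  rw [this]
  refine .iUnion fun n => .inter ?_ ?_
  · exact (measurable_list_length.comp measurable_snd) (measurableSet_singleton n)
  · have hg : Measurable fun p : γ × List α => (p.1, fun i : Fin n => p.2.getD i default) :=
      measurable_fst.prodMk (measurable_pi_iff.2 fun i =>
        (measurable_list_getD i).comp measurable_snd)
    exact ((h n).comp hg) hB

lemma measurable_list_tail : Measurable (List.tail : List α → List α) := by
  refine measurable_to_list ?_ fun i => ?_
  · simpa using measurable_list_length.sub_const 1
  · simpa [List.getD_eq_getElem?_getD] using measurable_list_getD (α := α) (i + 1)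

lemma measurable_prod_list_cases {f : γ × List α → β} (h0 : Measurable fun c => f (c, []))
    (h1 : Measurable fun p : γ × α × List α => f (p.1, p.2.1 :: p.2.2)) : Measurable f := by
  have hg : Measurable fun p : γ × List α => (p.1, p.2.getD 0 default, p.2.tail) :=
    measurable_fst.prodMk (((measurable_list_getD 0).comp measurable_snd).prodMk
      (measurable_list_tail.comp measurable_snd))
  have hs : MeasurableSet {p : γ × List α | p.2.length = 0} :=
    (measurable_list_length.comp measurable_snd) (measurableSet_singleton 0)
  have : f = fun p => if p.2.length = 0 then f (p.1, [])
      else f (p.1, p.2.getD 0 default :: p.2.tail) := by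
    funext ⟨c, l⟩
    cases l <;> simp
  rw [this]
  exact Measurable.ite hs (h0.comp measurable_fst) (h1.comp hg)

/-- Meant for quantities defined by recursion along the history, such as `started` and `finish`. -/
lemma measurable_prod_list_rec {f : γ × List α → β} {g : γ × α × List α × β → β}
    (h0 : Measurable fun c => f (c, [])) (hg : Measurable g)
    (h : ∀ c a l, f (c, a :: l) = g (c, a, l, f (c, l))) : Measurable f := by
  refine measurable_prod_list fun n => ?_
  induction n with
  | zero =>
    simp only [List.ofFn_zero]
    exact h0.comp measurable_fst
  | succ n ih =>
    simp only [List.ofFn_succ, h]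
    have ht : Measurable fun q : γ × (Fin (n + 1) → α) => (q.1, fun i : Fin n => q.2 i.succ) := by
      fun_prop
    exact hg.comp (measurable_fst.prodMk ((by fun_prop : Measurable
      fun q : γ × (Fin (n + 1) → α) => q.2 0).prodMk (((measurable_list_ofFn n).comp
        (measurable_snd.comp ht)).prodMk (ih.comp ht))))

instance measurableEq_list [MeasurableEq α] : MeasurableEq (List α) := by
  refine measurableEq_of_injective (f := fun l : List α => (l.length, fun i => l.getD i default))
    measurable_length_getD fun l l' h => ?_
  obtain ⟨h1, h2⟩ := Prod.ext_iff.1 h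
  refine List.ext_getElem h1 fun i hi hi' => ?_
  have := congrFun h2 i
  simpa [List.getD_eq_getElem?_getD, hi, hi'] using this

end ListMeasurable

end MultihopAge
end

noncomputable section

namespace MultihopAge

open Network

/-! ### Deadlines -/

namespace Network

/-- The first arrival at the gateway after time `u`. -/
def nextArrival (net : Network) (u : ℝ) : ℝ := sInf {t | u < t ∧ ∃ l, net.a l = t}

/-- There are infinitely many packets and only finitely many arrive in bounded time, so some arrive
after `u`, and the infimum is a minimum over a finite set. -/
lemma isLeast_nextArrival (net : Network) (u : ℝ) :
    IsLeast {t | u < t ∧ ∃ l, net.a l = t} (net.nextArrival u) := by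
  obtain ⟨l0, hl0⟩ := (net.finite_arrivals u).exists_notMem
  have hl0 : u < net.a l0 := not_le.1 hl0
  have hfin : {l | u < net.a l ∧ net.a l ≤ net.a l0}.Finite :=
    (net.finite_arrivals (net.a l0)).subset fun l hl => hl.2
  obtain ⟨l, ⟨hl1, hl2⟩, hmin⟩ := Set.exists_min_image _ net.a hfin ⟨l0, hl0, le_rfl⟩
  have : IsLeast {t | u < t ∧ ∃ l, net.a l = t} (net.a l) := by
    refine ⟨⟨hl1, l, rfl⟩, ?_⟩
    rintro _ ⟨ht, l', rfl⟩
    by_cases h : net.a l' ≤ net.a l0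
    · exact hmin l' ⟨ht, h⟩
    · exact hl2.trans (not_le.1 h).le
  rw [nextArrival, this.csInf_eq]
  exact this

lemma lt_nextArrival (net : Network) (u : ℝ) : u < net.nextArrival u :=
  (net.isLeast_nextArrival u).1.1

lemma nextArrival_le (net : Network) {u : ℝ} {l : ℕ} (h : u < net.a l) :
    net.nextArrival u ≤ net.a l :=
  (net.isLeast_nextArrival u).2 ⟨h, l, rfl⟩

lemma measurable_nextArrival (net : Network) : Measurable net.nextArrival := by
  refine Monotone.measurable fun u v huv => ?_
  obtain ⟨h, l, hl⟩ := (net.isLeast_nextArrival v).1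
  rw [← hl] at h ⊢
  exact net.nextArrival_le (huv.trans_lt h)

end Network

instance : MeasurableSpace (Option ℕ) := ⊤

instance : DiscreteMeasurableSpace (Option ℕ) := ⟨fun _ => trivial⟩

variable {net : Network} {R : Type*} [MeasurableSpace R]

namespace CausalPolicy

variable (π : CausalPolicy net R)

/-- The time of the next epoch if no transmission is completed before. -/
def deadline (r : R) (h : net.History) : ℝ :=
  if π.timer r h = ⊤ then net.nextArrival (now h)
  else min (net.nextArrival (now h)) (now h + (π.timer r h).toReal)

lemma now_lt_deadline (r : R) (h : net.History) : now h < π.deadline r h := by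
  unfold deadline
  split_ifs with ht
  · exact net.lt_nextArrival _
  · exact lt_min (net.lt_nextArrival _)
      (lt_add_of_pos_right _ (ENNReal.toReal_pos (π.timer_pos r h).ne' ht))

lemma deadline_le_arrival (r : R) {h : net.History} {l : ℕ} (hl : now h < net.a l) :
    π.deadline r h ≤ net.a l := by
  unfold deadline
  split_ifs with ht
  · exact net.nextArrival_le hl
  · exact (min_le_left _ _).trans (net.nextArrival_le hl)

lemma isLeast_deadline (r : R) (h : net.History) :
    IsLeast ({t | now h < t ∧ ∃ l, net.a l = t} ∪
      {t | π.timer r h ≠ ⊤ ∧ now h + (π.timer r h).toReal = t}) (π.deadline r h) := by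
  have hA := net.isLeast_nextArrival (now h)
  unfold deadline
  split_ifs with ht
  · simpa [ht] using hA
  · have : {t | π.timer r h ≠ ⊤ ∧ now h + (π.timer r h).toReal = t} =
        {now h + (π.timer r h).toReal} := by ext; simp [ht, eq_comm]
    rw [this]
    exact hA.union isLeast_singleton

lemma isLeast_nextTime (r : R) (x : net.Link × ℕ → ℝ) (h : net.History) :
    IsLeast (insert (π.deadline r h) {t | ∃ e, π.serve r h e ≠ none ∧ π.finish r x h e = t})
      (π.nextTime r x h) := by
  have hfin : {t | ∃ e, π.serve r h e ≠ none ∧ π.finish r x h e = t}.Finite :=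
    (Set.finite_range (π.finish r x h)).subset fun t ⟨e, _, he⟩ => ⟨e, he⟩
  obtain ⟨m, hm⟩ : ∃ m, IsLeast (insert (π.deadline r h)
      {t | ∃ e, π.serve r h e ≠ none ∧ π.finish r x h e = t}) m := by
    obtain ⟨m, hm, hmin⟩ := Set.exists_min_image _ id (hfin.insert (π.deadline r h))
      ⟨_, Set.mem_insert _ _⟩
    exact ⟨m, hm, hmin⟩
  have hD := π.isLeast_deadline r h
  have : IsLeast ({t | now h < t ∧ ∃ l, net.a l = t} ∪
      {t | ∃ e, π.serve r h e ≠ none ∧ π.finish r x h e = t} ∪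
      {t | π.timer r h ≠ ⊤ ∧ now h + (π.timer r h).toReal = t}) m := by
    rw [Set.union_right_comm]
    constructor
    · rcases hm.1 with h1 | h1
      · exact Or.inl (h1 ▸ hD.1)
      · exact Or.inr h1
    · rintro t (ht | ht)
      · exact (hm.2 (Set.mem_insert _ _)).trans (hD.2 ht)
      · exact hm.2 (Set.mem_insert_of_mem _ ht)
  rw [Rule.nextTime, this.csInf_eq]
  exact hm

/-- An idle link contributes the deadline, which competes anyway. The index set thus no longer
depends on the history, and measurability can be read off. -/
lemma nextTime_eq_iInf (r : R) (x : net.Link × ℕ → ℝ) (h : net.History) :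
    π.nextTime r x h = ⨅ o : Option net.Link, o.elim (π.deadline r h) fun e =>
      if π.serve r h e = none then π.deadline r h else π.finish r x h e := by
  have hl := π.isLeast_nextTime r x h
  set f : Option net.Link → ℝ := fun o => o.elim (π.deadline r h) fun e =>
      if π.serve r h e = none then π.deadline r h else π.finish r x h e with hf
  have hmem : ∀ o, f o ∈ insert (π.deadline r h)
      {t | ∃ e, π.serve r h e ≠ none ∧ π.finish r x h e = t} := by
    rintro (_ | e)
    · exact Or.inl rfl
    · by_cases he : π.serve r h e = none
      · left; simp [hf, he]
      · right; exact ⟨e, he, by simp [hf, he]⟩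
  apply le_antisymm
  · exact le_ciInf fun o => hl.2 (hmem o)
  · have hb : BddBelow (Set.range f) := (Set.finite_range f).bddBelow
    rcases hl.1 with h1 | ⟨e, he, h1⟩
    · rw [h1]; exact ciInf_le hb none
    · rw [← h1]
      have := ciInf_le hb (some e)
      simpa [hf, he] using this

/-! ### Measurability -/

lemma measurable_serve_prod (e : net.Link) :
    Measurable fun p : R × net.History => π.serve p.1 p.2 e :=
  measurable_prod_list fun n => measurable_to_countable' fun o => π.measurable_serve n e o

lemma measurable_timer_prod : Measurable fun p : R × net.History => π.timer p.1 p.2 :=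
  measurable_prod_list fun n => π.measurable_timer n

lemma _root_.MultihopAge.Network.measurable_now :
    Measurable (now : net.History → ℝ) := by
  have : Measurable fun p : Unit × net.History => now p.2 :=
    measurable_prod_list_cases measurable_const
      ((by fun_prop : Measurable fun p : Unit × net.Obs × net.History => p.2.1.1))
  exact this.comp (measurable_const (a := ()) |>.prodMk measurable_id)

lemma measurable_deadline : Measurable fun p : R × net.History => π.deadline p.1 p.2 := by
  have h1 := π.measurable_timer_prod
  have h2 : Measurable fun p : R × net.History => now p.2 := measurable_now.comp measurable_snd
  have h3 := net.measurable_nextArrival.comp h2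
  unfold deadline
  exact Measurable.ite (h1 (measurableSet_singleton ⊤)) h3 (h3.min (h2.add h1.ennreal_toReal))

lemma measurable_busy (e : net.Link) :
    Measurable fun p : R × net.History => π.serve p.1 p.2 e ≠ none :=
  (Measurable.eq (π.measurable_serve_prod e) measurable_const).not

lemma measurable_current (e : net.Link) :
    Measurable fun p : R × net.History => π.current p.1 p.2 e := by
  refine measurable_prod_list_cases measurable_const ?_
  simp only [Rule.current]
  refine Measurable.ite ?_ measurable_const ?_
  · exact measurableSet_setOfPred.2 ((measurable_set_mem e).comp
      (by fun_prop : Measurable fun p : R × net.Obs × net.History => p.2.1.2))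
  · exact (π.measurable_serve_prod e).comp
      (by fun_prop : Measurable fun p : R × net.Obs × net.History => (p.1, p.2.2))

lemma starts_iff (r : R) (h : net.History) (e : net.Link) :
    π.Starts r h e ↔ π.serve r h e ≠ none ∧ π.serve r h e ≠ π.current r h e := by
  unfold Rule.Starts
  cases hs : π.serve r h e <;> simp [eq_comm]

lemma measurable_starts (e : net.Link) :
    Measurable fun p : R × net.History => π.Starts p.1 p.2 e := by
  simp only [starts_iff]
  exact (π.measurable_busy e).and
    (Measurable.eq (π.measurable_serve_prod e) (π.measurable_current e)).not

lemma measurable_started (e : net.Link) :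
    Measurable fun p : R × net.History => π.started p.1 p.2 e := by
  classical
  have hs := π.measurable_starts e
  refine measurable_prod_list_rec (g := fun p => p.2.2.2 +
    if π.Starts p.1 (p.2.1 :: p.2.2.1) e then 1 else 0) ?_ ?_ fun c a l => ?_
  · simp only [Rule.started]
    exact Measurable.ite (measurableSet_setOfPred.2
      (hs.comp (measurable_id.prodMk measurable_const))) measurable_const measurable_const
  · have hcons : Measurable fun p : R × net.Obs × net.History × ℕ => (p.1, p.2.1 :: p.2.2.1) :=
      measurable_fst.prodMk (measurable_list_cons.comp
        (by fun_prop : Measurable fun p : R × net.Obs × net.History × ℕ => (p.2.1, p.2.2.1)))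
    exact Measurable.add (by fun_prop) (Measurable.ite (measurableSet_setOfPred.2
      (hs.comp hcons)) measurable_const measurable_const)
  · simp only [Rule.started]

lemma measurable_finish (e : net.Link) :
    Measurable fun p : (R × (net.Link × ℕ → ℝ)) × net.History => π.finish p.1.1 p.1.2 p.2 e := by
  classical
  have hs := π.measurable_starts e
  have hcons : Measurable fun p : (R × (net.Link × ℕ → ℝ)) × net.Obs × net.History × ℝ =>
      (p.1.1, p.2.1 :: p.2.2.1) :=
    (by fun_prop : Measurable fun p : (R × (net.Link × ℕ → ℝ)) × net.Obs × net.History × ℝ =>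
      p.1.1).prodMk (measurable_list_cons.comp
      (by fun_prop : Measurable fun p : (R × (net.Link × ℕ → ℝ)) × net.Obs × net.History × ℝ =>
        (p.2.1, p.2.2.1)))
  refine measurable_prod_list_rec (g := fun p =>
    if π.Starts p.1.1 (p.2.1 :: p.2.2.1) e then p.2.1.1 + p.1.2 (e, π.started p.1.1 p.2.2.1 e)
    else p.2.2.2) ?_ ?_ fun c a l => ?_
  · simp only [Rule.finish]; fun_prop
  · refine Measurable.ite (measurableSet_setOfPred.2 (hs.comp hcons)) ?_ (by fun_prop)
    refine Measurable.add (by fun_prop) ?_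
    have h1 : Measurable fun q : (net.Link × ℕ → ℝ) × ℕ => q.1 (e, q.2) :=
      measurable_from_prod_countable_left fun n => measurable_pi_apply (e, n)
    exact h1.comp (Measurable.prodMk (by fun_prop) ((π.measurable_started e).comp
      (by fun_prop : Measurable fun p : (R × (net.Link × ℕ → ℝ)) × net.Obs × net.History × ℝ =>
        (p.1.1, p.2.2.1))))
  · simp only [Rule.finish]

lemma measurable_nextTime :
    Measurable fun p : (R × (net.Link × ℕ → ℝ)) × net.History => π.nextTime p.1.1 p.1.2 p.2 := by
  have hp : Measurable fun p : (R × (net.Link × ℕ → ℝ)) × net.History => (p.1.1, p.2) := by fun_prop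
  have hD := π.measurable_deadline.comp hp
  simp only [nextTime_eq_iInf]
  refine Measurable.iInf fun o => ?_
  cases o with
  | none => exact hD
  | some e =>
    exact Measurable.ite (measurableSet_setOfPred.2 (Measurable.eq
      ((π.measurable_serve_prod e).comp hp) measurable_const)) hD (π.measurable_finish e)

lemma measurable_nextObs :
    Measurable fun p : (R × (net.Link × ℕ → ℝ)) × net.History => π.nextObs p.1.1 p.1.2 p.2 := by
  have hp : Measurable fun p : (R × (net.Link × ℕ → ℝ)) × net.History => (p.1.1, p.2) := by fun_prop
  refine π.measurable_nextTime.prodMk (measurable_set_iff.2 fun e => ?_)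
  exact ((π.measurable_busy e).comp hp).and
    (Measurable.eq (π.measurable_finish e) π.measurable_nextTime)

lemma measurable_run (n : ℕ) :
    Measurable fun ω : R × (net.Link × ℕ → ℝ) => π.run ω n := by
  induction n with
  | zero => exact measurable_const
  | succ n ih =>
    exact measurable_list_cons.comp
      ((π.measurable_nextObs.comp (measurable_id.prodMk ih)).prodMk ih)

lemma measurable_mem_arrivals (j : net.Node) (l : ℕ) :
    Measurable fun p : R × net.History => l ∈ π.arrivals p.1 p.2 j := by
  refine measurable_prod_list_cases measurable_const ?_
  simp only [Rule.arrivals, Set.mem_ofPred_eq]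
  refine Measurable.or ?_ (Measurable.exists fun e => ?_)
  · exact measurable_const.and (Measurable.eq measurable_const (by fun_prop))
  · refine ((measurable_set_mem e).comp
      (by fun_prop : Measurable fun p : R × net.Obs × net.History => p.2.1.2)).and
      (measurable_const.and (Measurable.eq ((π.measurable_serve_prod e).comp
        (by fun_prop : Measurable fun p : R × net.Obs × net.History => (p.1, p.2.2)))
          measurable_const))

lemma measurable_arrivedBy (t : ℝ) (j : net.Node) (l : ℕ) :
    Measurable fun ω : R × (net.Link × ℕ → ℝ) => π.ArrivedBy ω t j l := by
  unfold Rule.ArrivedBy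
  refine measurable_const.or (Measurable.exists fun n => Measurable.and ?_ ?_)
  · exact measurableSet_setOfPred.1
      (measurableSet_le (measurable_now.comp (π.measurable_run n)) measurable_const)
  · exact (π.measurable_mem_arrivals j l).comp (measurable_fst.prodMk (π.measurable_run n))

/-- Packets that have not arrived contribute the value `0`, which is in the set already. Both sides
are suprema of the same set, so no boundedness is needed. -/
lemma freshest_eq_iSup (ω : R × (net.Link × ℕ → ℝ)) (t : ℝ) (j : net.Node)
    [∀ l, Decidable (π.ArrivedBy ω t j l)] :
    π.freshest ω t j = ⨆ o : Option ℕ, o.elim 0 fun l =>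
      if π.ArrivedBy ω t j l then net.s l else 0 := by
  unfold Rule.freshest iSup
  congr 1
  ext u
  simp only [Set.mem_insert_iff, Set.mem_ofPred_eq, Set.mem_range]
  constructor
  · rintro (rfl | ⟨l, hl, rfl⟩)
    · exact ⟨none, rfl⟩
    · exact ⟨some l, by simp [hl]⟩
  · rintro ⟨_ | l, rfl⟩
    · exact Or.inl rfl
    · by_cases hl : π.ArrivedBy ω t j l
      · exact Or.inr ⟨l, hl, by simp [hl]⟩
      · exact Or.inl (by simp [hl])

lemma measurable_age (t : ℝ≥0) : Measurable fun ω => π.age ω t := by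
  classical
  refine measurable_pi_iff.2 fun j => ?_
  simp only [Rule.age, freshest_eq_iSup]
  refine measurable_const.sub (Measurable.iSup fun o => ?_)
  cases o with
  | none => exact measurable_const
  | some l =>
    exact Measurable.ite (measurableSet_setOfPred.2 (π.measurable_arrivedBy _ _ _))
      measurable_const measurable_const

end CausalPolicy

end MultihopAge
end

noncomputable section

namespace MultihopAge

open Network

/-! ### Ticks of the clocks -/

section Ticks

variable {L : Type*} [Fintype L] [DecidableEq L]

/-- The times at which the clocks in row `c` expire one after the other when they are started
at time `t`. -/
def ticks {κ : Type*} (t : ℝ) (z : κ × ℕ → ℝ) (c : κ) : Set ℝ :=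
  {T | ∃ K : ℕ, T = t + ∑ k ∈ Finset.range (K + 1), z (c, k)}

lemma lt_of_mem_ticks {κ : Type*} {t T : ℝ} {z : κ × ℕ → ℝ} {c : κ} (hz : ∀ p, 0 < z p)
    (h : T ∈ ticks t z c) : t < T := by
  obtain ⟨K, rfl⟩ := h
  exact lt_add_of_pos_right _ (Finset.sum_pos (fun k _ => hz _) (by simp))

lemma finite_ticks_le {κ : Type*} {t : ℝ} {z : κ × ℕ → ℝ} {c : κ} (hz : ∀ p, 0 < z p)
    (hd : RowsDiverge z) (C : ℝ) : {T | T ∈ ticks t z c ∧ T ≤ C}.Finite := by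
  obtain ⟨K0, hK0⟩ := hd c (C - t)
  refine ((Set.finite_Iio K0).image
    fun K => t + ∑ k ∈ Finset.range (K + 1), z (c, k)).subset ?_
  rintro _ ⟨⟨K, rfl⟩, hC⟩
  refine ⟨K, ?_, rfl⟩
  by_contra hK
  have : ∑ k ∈ Finset.range K0, z (c, k) ≤ ∑ k ∈ Finset.range (K + 1), z (c, k) :=
    Finset.sum_le_sum_of_subset_of_nonneg
      (by simp only [Set.mem_Iio, not_lt] at hK; simp; omega) fun i _ _ => (hz _).le
  linarith

lemma raceNext_row (s : L → Bool) (D : ℝ) (z : Clocks L) (e : L) (b : Bool) (k : ℕ) :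
    raceNext (fun e => (e, s e)) D z ((e, b), k) = if s e = b then
      (if z ((e, b), 0) = raceTime (fun e => (e, s e)) D z then z ((e, b), k + 1)
        else if k = 0 then z ((e, b), 0) - raceTime (fun e => (e, s e)) D z else z ((e, b), k))
      else z ((e, b), k) := by
  have h : (∃ e', (e', s e') = (e, b)) ↔ s e = b := by
    constructor
    · rintro ⟨e', h⟩
      obtain ⟨rfl, h⟩ := Prod.ext_iff.1 h
      exact h
    · rintro rfl; exact ⟨e, rfl⟩
  by_cases hs : s e = b
  · by_cases hk : k = 0 <;> simp [raceNext, hs, hk]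
  · simp [raceNext, hs]

lemma raceNext_pos {s : L → Bool} {D : ℝ} {z : Clocks L} (hz : ∀ p, 0 < z p) (p : (L × Bool) × ℕ) :
    0 < raceNext (fun e => (e, s e)) D z p := by
  obtain ⟨⟨e, b⟩, k⟩ := p
  rw [raceNext_row]
  split_ifs with h1 h2 h3
  · exact hz _
  · subst h1
    exact sub_pos.2 (lt_of_le_of_ne (raceTime_le (fun e => (e, s e)) D z e) (Ne.symm h2))
  · exact hz _
  · exact hz _

lemma dropRows_pos {S : Set L} {z : Clocks L} (hz : ∀ p, 0 < z p) (p : (L × Bool) × ℕ) :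
    0 < dropRows S z p := by
  unfold dropRows; split_ifs <;> exact hz _

/-- Dropping finitely many entries of a row and correcting its head changes the partial sums by a
bounded amount only. -/
lemma rowsDiverge_of_rows {κ : Type*} {z z' : κ × ℕ → ℝ} (hz : RowsDiverge z)
    (h : ∀ c, ∃ (b : ℕ) (a : ℝ), ∀ k, z' (c, k) = z (c, k + b) - if k = 0 then a else 0) :
    RowsDiverge z' := by
  intro c C
  obtain ⟨b, a, h⟩ := h c
  -- The second entry of the maximum forces `b ≤ K`; the first absorbs the dropped entries and the
  -- correction of the head.
  obtain ⟨K, hK⟩ := hz c (max (C + |a| + ∑ k ∈ Finset.range b, z (c, k))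
    (∑ k ∈ Finset.range b, |z (c, k)|))
  have hbK : b ≤ K := by
    by_contra hlt
    have h1 := (le_max_right _ _).trans_lt hK
    have h2 : ∑ k ∈ Finset.range K, z (c, k) ≤ ∑ k ∈ Finset.range b, |z (c, k)| :=
      (Finset.sum_le_sum fun k _ => le_abs_self _).trans
        (Finset.sum_le_sum_of_subset_of_nonneg (by simp; omega) fun i _ _ => abs_nonneg _)
    linarith
  obtain ⟨K, rfl⟩ := Nat.exists_eq_add_of_le hbK
  refine ⟨K, ?_⟩
  have h1 := (le_max_left _ _).trans_lt hK
  rw [Finset.sum_range_add] at h1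
  simp only [h, Finset.sum_sub_distrib]
  have h2 : ∑ k ∈ Finset.range K, (if k = 0 then a else 0) ≤ |a| := by
    rw [Finset.sum_ite_eq']
    split_ifs
    · exact le_abs_self a
    · exact abs_nonneg a
  simp only [add_comm b] at h1
  linarith

lemma rowsDiverge_raceNext {s : L → Bool} {D : ℝ} {z : Clocks L} (hz : RowsDiverge z) :
    RowsDiverge (raceNext (fun e => (e, s e)) D z) := by
  refine rowsDiverge_of_rows hz fun ⟨e, b⟩ => ?_
  simp only [raceNext_row]
  by_cases h1 : s e = b
  · by_cases h2 : z ((e, b), 0) = raceTime (fun e => (e, s e)) D z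
    · exact ⟨1, 0, fun k => by simp [h1, h2]⟩
    · refine ⟨0, raceTime (fun e => (e, s e)) D z, fun k => ?_⟩
      by_cases hk : k = 0 <;> simp [h1, h2, hk]
  · exact ⟨0, 0, fun k => by simp [h1]⟩

lemma rowsDiverge_dropRows {S : Set L} {z : Clocks L} (hz : RowsDiverge z) :
    RowsDiverge (dropRows S z) := by
  refine rowsDiverge_of_rows hz fun c => ?_
  by_cases h : c.2 = true ∧ c.1 ∈ S
  · exact ⟨1, 0, fun k => by simp [dropRows, h]⟩
  · exact ⟨0, 0, fun k => by simp [dropRows, h]⟩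

variable {s : L → Bool} {D t T : ℝ} {z z' : Clocks L} {e : L}

lemma mem_ticks_of_mem_raceObs (h : e ∈ (raceObs (fun e => (e, s e)) D z).2) :
    t + (raceObs (fun e => (e, s e)) D z).1 ∈ ticks t z (e, s e) := by
  refine ⟨0, ?_⟩
  have h : z ((e, s e), 0) = raceTime (fun e => (e, s e)) D z := h
  simp [h, raceObs]

/-- While the clock of a row runs, its residual time shrinks exactly by the time elapsed, so the
absolute expiry times do not move. Only the row in question is constrained in `z'`, which leaves
room for discards in other rows. -/
lemma mem_ticks_of_mem_ticks_race
    (hz' : ∀ k, z' ((e, s e), k) = raceNext (fun e => (e, s e)) D z ((e, s e), k))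
    (h : T ∈ ticks (t + (raceObs (fun e => (e, s e)) D z).1) z' (e, s e)) :
    T ∈ ticks t z (e, s e) := by
  obtain ⟨K, rfl⟩ := h
  simp only [raceObs, hz', raceNext_row, if_true]
  by_cases h : z ((e, s e), 0) = raceTime (fun e => (e, s e)) D z
  · refine ⟨K + 1, ?_⟩
    simp only [h, if_true]
    rw [Finset.sum_range_succ' _ (K + 1), h]
    ring
  · refine ⟨K, ?_⟩
    simp only [h, if_false]
    rw [Finset.sum_range_succ', Finset.sum_range_succ' (fun k => z ((e, s e), k))]
    simp
    ring

lemma mem_ticks_race_of_mem_ticks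
    (hz' : ∀ k, z' ((e, s e), k) = raceNext (fun e => (e, s e)) D z ((e, s e), k))
    (h : T ∈ ticks t z (e, s e)) :
    T ∈ ticks (t + (raceObs (fun e => (e, s e)) D z).1) z' (e, s e) ∨
      e ∈ (raceObs (fun e => (e, s e)) D z).2 ∧ T = t + (raceObs (fun e => (e, s e)) D z).1 := by
  obtain ⟨K, rfl⟩ := h
  by_cases h : z ((e, s e), 0) = raceTime (fun e => (e, s e)) D z
  · cases K with
    | zero => right; exact ⟨h, by simp [raceObs, h]⟩
    | succ K =>
      left
      refine ⟨K, ?_⟩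
      simp only [raceObs, hz', raceNext_row, if_true, h]
      rw [Finset.sum_range_succ' _ (K + 1), h]
      ring
  · left
    refine ⟨K, ?_⟩
    simp only [raceObs, hz', raceNext_row, if_true, h, if_false]
    rw [Finset.sum_range_succ', Finset.sum_range_succ' _ K]
    simp
    ring

end Ticks

/-! ### The system driven by clocks that run all the time -/

variable {net : Network} {R : Type*} [MeasurableSpace R]

namespace CausalPolicy

variable (π : CausalPolicy net R) (r : R)

/-- The first event `o` of a race in state `q` (the time and the history so far) is an epoch of
the system, and not just the expiry of the clock of an idle link. -/
def Fires (q : ℝ × net.History) (o : net.Obs) : Prop :=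
  q.1 + o.1 = π.deadline r q.2 ∨ ∃ e ∈ o.2, π.serve r q.2 e ≠ none

/-- The state after the first event of a race. -/
def nextState (q : ℝ × net.History) (o : net.Obs) : ℝ × net.History :=
  open Classical in
  (q.1 + o.1, if π.Fires r q o then (q.1 + o.1, {e | e ∈ o.2 ∧ π.serve r q.2 e ≠ none}) :: q.2
    else q.2)

lemma measurable_serve_right (e : net.Link) :
    Measurable fun h : net.History => π.serve r h e :=
  (π.measurable_serve_prod e).comp (measurable_const.prodMk measurable_id)

lemma measurable_fires : Measurable fun p : (ℝ × net.History) × net.Obs => π.Fires r p.1 p.2 := by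
  have hD : Measurable fun h : net.History => π.deadline r h :=
    π.measurable_deadline.comp (measurable_const.prodMk measurable_id)
  refine Measurable.or (Measurable.eq (by fun_prop) (hD.comp (by fun_prop))) ?_
  refine Measurable.exists fun e => ((measurable_set_mem e).comp (by fun_prop)).and ?_
  exact (Measurable.eq ((π.measurable_serve_right r e).comp (by fun_prop)) measurable_const).not

lemma measurable_nextState :
    Measurable fun p : (ℝ × net.History) × net.Obs => π.nextState r p.1 p.2 := by
  have ht : Measurable fun p : (ℝ × net.History) × net.Obs => p.1.1 + p.2.1 := by fun_prop
  refine ht.prodMk (Measurable.ite (measurableSet_setOfPred.2 (π.measurable_fires r)) ?_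
    (by fun_prop))
  refine measurable_list_cons.comp ((ht.prodMk (measurable_set_iff.2 fun e => ?_)).prodMk
    (by fun_prop))
  exact ((measurable_set_mem e).comp (by fun_prop)).and
    (Measurable.eq ((π.measurable_serve_right r e).comp (by fun_prop)) measurable_const).not

/-- The dynamics of the system observed at all expiries of clocks. -/
def dynamics : Dynamics (ℝ × net.History) net.Link where
  -- The truncation matters only in states that are never reached; by `Regular` the difference is
  -- positive along every run with positive clocks.
  deadline q := max (π.deadline r q.2 - q.1) 0
  next := π.nextState r
  deadline_nonneg _ := le_max_right _ _
  measurable_deadline := by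
    have hD : Measurable fun h : net.History => π.deadline r h :=
      π.measurable_deadline.comp (measurable_const.prodMk measurable_id)
    exact ((hD.comp measurable_snd).sub measurable_fst).max measurable_const
  measurable_next := π.measurable_nextState r

/-- The control under which the clocks in the `true` rows are the transmission times, while those
in the `false` rows run when the link is idle. -/
def ownControl : Control (ℝ × net.History) net.Link where
  sel q e := (π.serve r q.2 e).isSome
  -- These are the interrupted transmissions: their residual time is thrown away so that the next
  -- transmission time comes to the head of the row. A completed one has already been removed by the
  -- race, and the row of an idle link shows its next time anyway.
  disc q o := {e | π.Fires r q o ∧ π.current r (π.nextState r q o).2 e ≠ none ∧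
    π.serve r (π.nextState r q o).2 e ≠ π.current r (π.nextState r q o).2 e}
  measurable_sel := by
    have h : Measurable (Option.isSome : Option ℕ → Bool) := .of_discrete
    exact measurable_pi_iff.2 fun e => h.comp ((π.measurable_serve_right r e).comp measurable_snd)
  measurable_disc := by
    have hc : ∀ e, Measurable fun h : net.History => π.current r h e := fun e =>
      (π.measurable_current e).comp (measurable_const.prodMk measurable_id)
    have hn := measurable_snd.comp (π.measurable_nextState r)
    refine measurable_set_iff.2 fun e => (π.measurable_fires r).and (Measurable.and ?_ ?_)
    · exact (Measurable.eq ((hc e).comp hn) measurable_const).not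
    · exact (Measurable.eq ((π.measurable_serve_right r e).comp hn) ((hc e).comp hn)).not

/-- The control under which the clocks in the `true` rows always run. -/
def commonControl (net : Network) : Control (ℝ × net.History) net.Link :=
  ⟨fun _ _ => true, fun _ _ => ∅, measurable_const, measurable_const⟩

end CausalPolicy

end MultihopAge
end

noncomputable section

namespace MultihopAge

open Network

variable {net : Network} {R : Type*} [MeasurableSpace R]

namespace CausalPolicy

variable (π : CausalPolicy net R) (r : R)

/-! ### Packets along a history -/

/-- The packets at the disposal of a link have arrived at its origin. -/
lemma exists_arrival_of_available (e : net.Link) {l : ℕ} :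
    ∀ {h : net.History}, l ∈ π.available r h e → ∃ h', h' <:+ h ∧ l ∈ π.arrivals r h' e.1.1
  | [], hl => by
    rcases hl with hl | hl | hl
    · simp [Rule.current] at hl
    · simp [Rule.waiting] at hl
    · exact ⟨[], List.suffix_rfl, hl⟩
  | o :: h, hl => by
    have ih : l ∈ π.available r h e → ∃ h', h' <:+ o :: h ∧ l ∈ π.arrivals r h' e.1.1 := fun h1 =>
      let ⟨h', h2, h3⟩ := exists_arrival_of_available e h1
      ⟨h', h2.trans (List.suffix_cons o h), h3⟩
    rcases hl with hl | hl | hl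
    · simp only [Rule.current] at hl
      split_ifs at hl
      exact ih (π.serve_available r h e l hl)
    · exact ih (π.queue_available r h e l hl)
    · exact ⟨_, List.suffix_rfl, hl⟩

lemma exists_arrival_of_serve {e : net.Link} {l : ℕ} {h : net.History}
    (hl : π.serve r h e = some l) : ∃ h', h' <:+ h ∧ l ∈ π.arrivals r h' e.1.1 :=
  π.exists_arrival_of_available r e (π.serve_available r h e l hl)

/-- The content of `o` is irrelevant: what was received before it is what arrived along `h`. -/
lemma exists_arrival_of_receivedBefore {v : net.Node} {l : ℕ} {o : net.Obs} :
    ∀ {h : net.History}, l ∈ π.receivedBefore r (o :: h) v →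
      ∃ h', h' <:+ h ∧ l ∈ π.arrivals r h' v
  | [], hl => by
    rcases hl with hl | hl
    · exact hl.elim
    · exact ⟨[], List.suffix_rfl, hl⟩
  | o' :: h, hl => by
    rcases hl with hl | hl
    · obtain ⟨h', h1, h2⟩ := exists_arrival_of_receivedBefore (o := o') hl
      exact ⟨h', h1.trans (List.suffix_cons o' h), h2⟩
    · exact ⟨_, List.suffix_rfl, hl⟩

variable {π}

lemma IsPreemptiveLGFS.exists_serve (hπ : π.IsPreemptiveLGFS) {h : net.History} {e : net.Link}
    {l : ℕ} (hl : l ∈ π.contenders r h e) :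
    ∃ l', π.serve r h e = some l' ∧ net.s l ≤ net.s l' := by
  cases hs : π.serve r h e with
  | none => rw [hπ.idle r h e hs] at hl; exact hl.elim
  | some l' => exact ⟨l', rfl, hπ.freshest_first r h e l' hs l hl⟩

/-- Under preemptive LGFS, a link transmits a packet that is at least as fresh as any packet
received by its origin, unless its destination has received such a packet. -/
lemma IsPreemptiveLGFS.exists_serve_or_arrival (hπ : π.IsPreemptiveLGFS) (e : net.Link) {l : ℕ} :
    ∀ {h h' : net.History}, h' <:+ h → l ∈ π.arrivals r h' e.1.1 →
      (∃ l', π.serve r h e = some l' ∧ net.s l ≤ net.s l') ∨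
      ∃ h'', h'' <:+ h ∧ ∃ l' ∈ π.arrivals r h'' e.1.2, net.s l ≤ net.s l'
  | [], h', hh, hl => by
    obtain rfl := List.suffix_nil.1 hh
    exact Or.inl (hπ.exists_serve r (Or.inl (Or.inr (Or.inr ⟨hl, fun h => h.elim⟩))))
  | o :: h, h', hh, hl => by
    have old : ∀ {h'}, h' <:+ h → l ∈ π.arrivals r h' e.1.1 →
        (∃ l', π.serve r (o :: h) e = some l' ∧ net.s l ≤ net.s l') ∨
        ∃ h'', h'' <:+ o :: h ∧ ∃ l' ∈ π.arrivals r h'' e.1.2, net.s l ≤ net.s l' := by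
      intro h' hh hl
      rcases exists_serve_or_arrival hπ e hh hl with ⟨l', h1, h2⟩ | ⟨h'', h1, h2⟩
      · by_cases he : e ∈ o.2
        · exact Or.inr ⟨o :: h, List.suffix_rfl, l', Or.inr ⟨e, he, rfl, h1⟩, h2⟩
        -- An uncompleted transmission contends at the next decision, so it can only give way to a
        -- packet at least as fresh.
        · have hc : π.current r (o :: h) e = some l' := by simp [Rule.current, he, h1]
          obtain ⟨l'', h3, h4⟩ := hπ.exists_serve r (Or.inl (Or.inl hc))
          exact Or.inl ⟨l'', h3, h2.trans h4⟩
      · exact Or.inr ⟨h'', h1.trans (List.suffix_cons o h), h2⟩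
    rcases List.suffix_cons_iff.1 hh with rfl | hh
    -- A repeated copy may be refused and then does not contend; in that case an earlier arrival of
    -- the same packet serves instead.
    · by_cases hr : l ∈ π.receivedBefore r (o :: h) e.1.1
      · obtain ⟨h', h1, h2⟩ := π.exists_arrival_of_receivedBefore r hr
        exact old h1 h2
      · exact Or.inl (hπ.exists_serve r (Or.inl (Or.inr (Or.inr ⟨hl, hr⟩))))
    · exact old hh hl

variable (π)

/-! ### The states of the clock-driven system -/

/-- The state (time, history, clocks) after `n` races when the system is started at time `0` with
clocks `z`. -/
def state (c : Control (ℝ × net.History) net.Link) (z : Clocks net.Link) (n : ℕ) :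
    (ℝ × net.History) × Clocks net.Link :=
  (π.dynamics r).chain c (0, []) z n

/-- The outcome of race `n`. -/
def stateObs (c : Control (ℝ × net.History) net.Link) (z : Clocks net.Link) (n : ℕ) : net.Obs :=
  (π.dynamics r).obs c (π.state r c z n)

/-- The clocks are positive and the current time lies between the last epoch and the deadline. -/
structure Regular (s : (ℝ × net.History) × Clocks net.Link) : Prop where
  pos : ∀ p, 0 < s.2 p
  now_le : now s.1.2 ≤ s.1.1
  lt_deadline : s.1.1 < π.deadline r s.1.2

variable {π r} {c : Control (ℝ × net.History) net.Link}
  {s : (ℝ × net.History) × Clocks net.Link} {z : Clocks net.Link}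

namespace Regular

variable (hs : π.Regular r s)
include hs

lemma obs_eq : (π.dynamics r).obs c s =
    raceObs (fun e => (e, c.sel s.1 e)) (π.deadline r s.1.2 - s.1.1) s.2 := by
  have : max (π.deadline r s.1.2 - s.1.1) 0 = π.deadline r s.1.2 - s.1.1 :=
    max_eq_left (sub_nonneg.2 hs.lt_deadline.le)
  simp only [Dynamics.obs, dynamics, this]

lemma step_clocks : ((π.dynamics r).step c s).2 =
    dropRows (c.disc s.1 ((π.dynamics r).obs c s))
      (raceNext (fun e => (e, c.sel s.1 e)) (π.deadline r s.1.2 - s.1.1) s.2) := by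
  have : max (π.deadline r s.1.2 - s.1.1) 0 = π.deadline r s.1.2 - s.1.1 :=
    max_eq_left (sub_nonneg.2 hs.lt_deadline.le)
  simp only [Dynamics.step, dynamics, this]

lemma time_lt : s.1.1 < ((π.dynamics r).step c s).1.1 := by
  change s.1.1 < s.1.1 + ((π.dynamics r).obs c s).1
  rw [hs.obs_eq]
  exact lt_add_of_pos_right _ (raceTime_pos (sub_pos.2 hs.lt_deadline) fun e => hs.pos _)

lemma time_le_deadline : ((π.dynamics r).step c s).1.1 ≤ π.deadline r s.1.2 := by
  change s.1.1 + ((π.dynamics r).obs c s).1 ≤ _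
  rw [hs.obs_eq]
  have : (raceObs (fun e => (e, c.sel s.1 e)) (π.deadline r s.1.2 - s.1.1) s.2).1 ≤ _ :=
    raceTime_le_deadline _ _ _
  linarith

/-- Strictness before the deadline survives because reaching the deadline always fires, and a new
epoch has a deadline strictly after its own time. -/
lemma step : π.Regular r ((π.dynamics r).step c s) := by
  have h1 := hs.time_lt (c := c)
  have h2 := hs.time_le_deadline (c := c)
  refine ⟨?_, ?_, ?_⟩
  · rw [hs.step_clocks]
    exact dropRows_pos (raceNext_pos hs.pos)
  · change now (π.nextState r s.1 _).2 ≤ _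
    simp only [nextState]
    split_ifs
    · exact le_rfl
    · exact hs.now_le.trans h1.le
  · change _ < π.deadline r (π.nextState r s.1 _).2
    simp only [nextState]
    split_ifs with hf
    · exact lt_of_eq_of_lt (by rfl) (π.now_lt_deadline r _)
    · exact h2.lt_of_ne fun h => hf (Or.inl h)

end Regular

lemma regular_state (hz : ∀ p, 0 < z p) (n : ℕ) : π.Regular r (π.state r c z n) := by
  induction n with
  | zero => exact ⟨hz, le_rfl, π.now_lt_deadline r []⟩
  | succ n ih => exact ih.step

lemma strictMono_time (hz : ∀ p, 0 < z p) : StrictMono fun n => (π.state r c z n).1.1 :=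
  strictMono_nat_of_lt_succ fun n => (regular_state hz n).time_lt

variable (π r) in
lemma state_succ_history (n : ℕ) :
    (π.state r c z (n + 1)).1.2 =
      open Classical in
      if π.Fires r (π.state r c z n).1 (π.stateObs r c z n) then
        ((π.state r c z (n + 1)).1.1,
          {e | e ∈ (π.stateObs r c z n).2 ∧
            π.serve r (π.state r c z n).1.2 e ≠ none}) :: (π.state r c z n).1.2
      else (π.state r c z n).1.2 := rfl

lemma history_suffix {m n : ℕ} (hmn : m ≤ n) :
    (π.state r c z m).1.2 <:+ (π.state r c z n).1.2 := by
  induction n, hmn using Nat.le_induction with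
  | base => exact List.suffix_rfl
  | succ n _ ih =>
    refine ih.trans ?_
    rw [state_succ_history]
    split_ifs
    · exact List.suffix_cons _ _
    · exact List.suffix_rfl

lemma exists_history_eq {n : ℕ} {h' : net.History} (hh : h' <:+ (π.state r c z n).1.2) :
    ∃ k ≤ n, (π.state r c z k).1.2 = h' := by
  induction n with
  | zero => exact ⟨0, le_rfl, (List.suffix_nil.1 hh).symm⟩
  | succ n ih =>
    have old : h' <:+ (π.state r c z n).1.2 → ∃ k ≤ n + 1, (π.state r c z k).1.2 = h' := fun h =>
      let ⟨k, hk, h1⟩ := ih h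
      ⟨k, hk.trans n.le_succ, h1⟩
    have hh' := hh
    rw [state_succ_history] at hh'
    split_ifs at hh' with hf
    · rcases List.suffix_cons_iff.1 hh' with h | h
      · exact ⟨n + 1, le_rfl, by rw [h, state_succ_history, if_pos hf]⟩
      · exact old h
    · exact old hh'

lemma now_suffix_le (hz : ∀ p, 0 < z p) {n : ℕ} {h' : net.History}
    (hh : h' <:+ (π.state r c z n).1.2) : now h' ≤ (π.state r c z n).1.1 := by
  obtain ⟨k, hk, rfl⟩ := exists_history_eq hh
  exact (regular_state hz k).now_le.trans ((strictMono_time hz).monotone hk)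

/-- Epochs before the end of race `n` belong to the history at its start. -/
lemma suffix_of_now_lt (hz : ∀ p, 0 < z p) {n k : ℕ}
    (h : now (π.state r c z k).1.2 < (π.state r c z (n + 1)).1.1) :
    (π.state r c z k).1.2 <:+ (π.state r c z n).1.2 := by
  rcases le_or_gt k n with hk | hk
  · exact history_suffix hk
  · suffices ∀ m, now (π.state r c z (n + 1 + m)).1.2 < (π.state r c z (n + 1)).1.1 →
        (π.state r c z (n + 1 + m)).1.2 = (π.state r c z n).1.2 by
      obtain ⟨m, rfl⟩ := Nat.exists_eq_add_of_le (Nat.succ_le_of_lt hk)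
      rw [this m h]
    intro m
    -- An epoch created at the end of race `n` or later carries a time not before the end of race
    -- `n`, contrary to the hypothesis; so no such epoch has been created.
    have fire : ∀ m, (π.state r c z (n + 1)).1.1 ≤ (π.state r c z (n + 1 + m)).1.1 := fun m =>
      (strictMono_time hz).monotone (Nat.le_add_right _ _)
    induction m with
    | zero =>
      intro h
      rw [add_zero, state_succ_history] at h ⊢
      split_ifs at h ⊢
      · exact absurd h (lt_irrefl _)
      · rfl
    | succ m ih =>
      intro h
      rw [← add_assoc, state_succ_history] at h ⊢
      split_ifs at h ⊢
      · exact absurd (h.trans_le (fire (m + 1))) (lt_irrefl _)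
      · exact ih h

/-- All arrivals at the gateway are epochs. -/
lemma exists_now_eq_arrival (hz : ∀ p, 0 < z p) {n l : ℕ}
    (hl : net.a l ≤ (π.state r c z n).1.1) :
    ∃ h', h' <:+ (π.state r c z n).1.2 ∧ now h' = net.a l := by
  induction n with
  | zero => exact ⟨[], List.suffix_rfl, le_antisymm ((net.s_nonneg l).trans (net.s_le_a l)) hl⟩
  | succ n ih =>
    rcases le_or_gt (net.a l) (π.state r c z n).1.1 with h | h
    · obtain ⟨h', h1, h2⟩ := ih h
      exact ⟨h', h1.trans (history_suffix n.le_succ), h2⟩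
    · have hr := regular_state (π := π) (r := r) (c := c) hz n
      have h1 := π.deadline_le_arrival r (hr.now_le.trans_lt h)
      have h2 : (π.state r c z (n + 1)).1.1 ≤ π.deadline r (π.state r c z n).1.2 :=
        hr.time_le_deadline
      have h3 : net.a l = (π.state r c z (n + 1)).1.1 := le_antisymm hl (h2.trans h1)
      refine ⟨_, List.suffix_rfl, ?_⟩
      have hf : π.Fires r (π.state r c z n).1 (π.stateObs r c z n) :=
        Or.inl (le_antisymm h2 (h1.trans hl))
      rw [state_succ_history, if_pos hf, h3]
      rfl

lemma mem_arrivals_of_now_eq {h : net.History} {l : ℕ} (hh : now h = net.a l) :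
    l ∈ π.arrivals r h 0 := by
  cases h with
  | nil => exact ⟨rfl, hh.symm⟩
  | cons o h => exact Or.inl ⟨rfl, hh.symm⟩

/-- Used to exclude that infinitely many races end at times from a finite set. -/
lemma not_strictMono_of_finite {f : ℕ → ℝ} (hf : StrictMono f) {F : Set ℝ} (hF : F.Finite)
    {n₀ : ℕ} (h : ∀ n, n₀ ≤ n → f n ∈ F) : False := by
  refine Set.infinite_of_injective_forall_mem (f := fun n => f (n₀ + n))
    (fun a b hab => ?_) (fun n => h _ (Nat.le_add_right _ _)) hF
  exact Nat.add_left_cancel (hf.injective hab)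

end CausalPolicy

end MultihopAge
end

noncomputable section

namespace MultihopAge

open Network

variable {net : Network} {R : Type*} [MeasurableSpace R]

namespace CausalPolicy

variable (π : CausalPolicy net R) (r : R)

/-! ### Comparison under common clocks -/

section Common

variable {z : Clocks net.Link}

variable {π r}

lemma time_succ {c : Control (ℝ × net.History) net.Link} (n : ℕ) :
    (π.state r c z (n + 1)).1.1 = (π.state r c z n).1.1 + (π.stateObs r c z n).1 := rfl

lemma common_clocks_succ (hz : ∀ p, 0 < z p) (n : ℕ) :
    (π.state r (commonControl net) z (n + 1)).2 = raceNext (fun e => (e, true))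
      (π.deadline r (π.state r (commonControl net) z n).1.2 -
        (π.state r (commonControl net) z n).1.1) (π.state r (commonControl net) z n).2 := by
  refine (regular_state (c := commonControl net) hz n).step_clocks.trans ?_
  funext p
  simp [dropRows, commonControl]

lemma common_obs (hz : ∀ p, 0 < z p) (n : ℕ) :
    π.stateObs r (commonControl net) z n = raceObs (fun e => (e, true))
      (π.deadline r (π.state r (commonControl net) z n).1.2 -
        (π.state r (commonControl net) z n).1.1) (π.state r (commonControl net) z n).2 :=
  (regular_state (c := commonControl net) hz n).obs_eq

/-- The common control never discards, so the `true` rows change by the passage of time only. The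
set `ticks 0 z (e, true)` is therefore a timetable shared by all policies. -/
lemma mem_ticks_of_mem_ticks_state (hz : ∀ p, 0 < z p) {e : net.Link} {T : ℝ} {n : ℕ}
    (h : T ∈ ticks (π.state r (commonControl net) z n).1.1
      (π.state r (commonControl net) z n).2 (e, true)) : T ∈ ticks 0 z (e, true) := by
  induction n with
  | zero => exact h
  | succ n ih =>
    refine ih (mem_ticks_of_mem_ticks_race (s := fun _ => true)
      (D := π.deadline r (π.state r (commonControl net) z n).1.2 -
        (π.state r (commonControl net) z n).1.1)
      (z' := (π.state r (commonControl net) z (n + 1)).2) (fun k => ?_) ?_)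
    · rw [common_clocks_succ hz]
    · rw [time_succ, common_obs hz] at h
      exact h

lemma time_mem_ticks (hz : ∀ p, 0 < z p) {e : net.Link} {n : ℕ}
    (h : e ∈ (π.stateObs r (commonControl net) z n).2) :
    (π.state r (commonControl net) z (n + 1)).1.1 ∈ ticks 0 z (e, true) := by
  refine mem_ticks_of_mem_ticks_state hz (n := n) (π := π) (r := r) ?_
  rw [time_succ, common_obs hz]
  rw [common_obs hz] at h
  exact mem_ticks_of_mem_raceObs (s := fun _ => true) h

/-- No entry of the timetable is skipped: it is still pending, or it has ended a race in which the
clock of `e` expired. -/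
lemma mem_ticks_state_or (hz : ∀ p, 0 < z p) {e : net.Link} {T : ℝ}
    (h : T ∈ ticks 0 z (e, true)) (n : ℕ) :
    T ∈ ticks (π.state r (commonControl net) z n).1.1
      (π.state r (commonControl net) z n).2 (e, true) ∨
    ∃ m, e ∈ (π.stateObs r (commonControl net) z m).2 ∧
      (π.state r (commonControl net) z (m + 1)).1.1 = T := by
  induction n with
  | zero => exact Or.inl h
  | succ n ih =>
    rcases ih with ih | ih
    · rcases mem_ticks_race_of_mem_ticks (s := fun _ => true)
        (D := π.deadline r (π.state r (commonControl net) z n).1.2 -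
          (π.state r (commonControl net) z n).1.1)
        (z' := (π.state r (commonControl net) z (n + 1)).2)
        (fun k => by rw [common_clocks_succ hz]) ih with h1 | ⟨h1, h2⟩
      · left
        rw [time_succ, common_obs hz]
        exact h1
      · right
        refine ⟨n, ?_, ?_⟩
        · rw [common_obs hz]; exact h1
        · rw [time_succ, common_obs hz, h2]
    · exact Or.inr ih

/-- Without timers, the system goes on for ever. -/
lemma exists_lt_time (hπ : π.IsPreemptiveLGFS) (hz : ∀ p, 0 < z p) (hd : RowsDiverge z) (C : ℝ) :
    ∃ n, C < (π.state r (commonControl net) z n).1.1 := by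
  by_contra! hC
  -- In the absence of timers a race ends with a tick or with an arrival at the gateway, and only
  -- finitely many of either occur up to `C`.
  have hF : ((⋃ e : net.Link, {T | T ∈ ticks 0 z (e, true) ∧ T ≤ C}) ∪
      net.a '' {l | net.a l ≤ C}).Finite :=
    (Set.finite_iUnion fun e => finite_ticks_le hz hd C).union ((net.finite_arrivals C).image _)
  refine not_strictMono_of_finite (strictMono_time (π := π) (r := r) (c := commonControl net) hz)
    hF (n₀ := 1) fun n hn => ?_
  obtain ⟨n, rfl⟩ := Nat.exists_eq_add_of_le' hn
  have ht := time_succ (π := π) (r := r) (c := commonControl net) (z := z) n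
  have ho := common_obs (π := π) (r := r) hz n
  rcases raceTime_eq (fun e : net.Link => (e, true))
    (π.deadline r (π.state r (commonControl net) z n).1.2 -
        (π.state r (commonControl net) z n).1.1) (π.state r (commonControl net) z n).2
    with h | ⟨e, h⟩
  · right
    have h2 : π.deadline r (π.state r (commonControl net) z n).1.2 =
        net.nextArrival (now (π.state r (commonControl net) z n).1.2) := by
      simp [deadline, hπ.timer_eq_top]
    have h1 : (π.state r (commonControl net) z (n + 1)).1.1 =
        net.nextArrival (now (π.state r (commonControl net) z n).1.2) := by
      rw [ht, ho, ← h2]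
      simp only [raceObs, h]
      ring
    obtain ⟨_, l, hl⟩ := (net.isLeast_nextArrival
      (now (π.state r (commonControl net) z n).1.2)).1
    exact ⟨l, by rw [Set.mem_ofPred_eq, hl, ← h1]; exact hC _, hl.trans h1.symm⟩
  · left
    refine Set.mem_iUnion.2 ⟨e, time_mem_ticks hz ?_, hC _⟩
    rw [ho]
    exact h.symm

variable (π r) in
/-- A packet generated at time `u` or later has arrived at node `j` by time `t`. -/
def HasFresh (z : Clocks net.Link) (t : ℝ) (j : net.Node) (u : ℝ) : Prop :=
  ∃ l, u ≤ net.s l ∧ ((j = 0 ∧ net.a l ≤ t) ∨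
    ∃ n, now (π.state r (commonControl net) z n).1.2 ≤ t ∧
      l ∈ π.arrivals r (π.state r (commonControl net) z n).1.2 j)

/-- Under preemptive LGFS, whenever the clock of a link expires its destination has received a
packet that is at least as fresh as those received by its origin before. -/
lemma IsPreemptiveLGFS.hasFresh_of_tick (hπ : π.IsPreemptiveLGFS) (hz : ∀ p, 0 < z p)
    (hd : RowsDiverge z) {e : net.Link} {T t u : ℝ} (hT : T ∈ ticks 0 z (e, true)) (ht : t < T)
    (h : π.HasFresh r z t e.1.1 u) : π.HasFresh r z T e.1.2 u := by
  obtain ⟨N, hN⟩ := exists_lt_time (π := π) (r := r) hπ hz hd T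
  -- Once the system has run past `T` the tick is no longer pending, so `T` is the end of some race
  -- `n`.
  obtain ⟨n, he, rfl⟩ := (mem_ticks_state_or (π := π) (r := r) hz hT N).resolve_left fun h =>
    absurd (lt_of_mem_ticks (regular_state hz N).pos h) hN.not_gt
  have hreg := regular_state (π := π) (r := r) (c := commonControl net) hz n
  have hlt := hreg.time_lt (c := commonControl net)
  change _ < (π.state r (commonControl net) z (n + 1)).1.1 at hlt
  obtain ⟨l, hul, hl⟩ := h
  have hsuf : ∃ h', h' <:+ (π.state r (commonControl net) z n).1.2 ∧
      l ∈ π.arrivals r h' e.1.1 := by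
    rcases hl with ⟨h0, hl⟩ | ⟨k, hk, hl⟩
    -- An arrival at the gateway before the end of race `n` cannot fall inside that race, since the
    -- deadline would have ended the race there.
    · have hln : net.a l ≤ (π.state r (commonControl net) z n).1.1 := by
        by_contra! hcon
        have h1 := π.deadline_le_arrival r (hreg.now_le.trans_lt hcon)
        have h2 := hreg.time_le_deadline (c := commonControl net)
        exact absurd ((hl.trans_lt ht).trans_le (h2.trans h1)) (lt_irrefl _)
      obtain ⟨h', h1, h2⟩ := exists_now_eq_arrival hz hln
      exact ⟨h', h1, h0 ▸ mem_arrivals_of_now_eq h2⟩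
    · exact ⟨_, suffix_of_now_lt hz (hk.trans_lt ht), hl⟩
  obtain ⟨h', hh', hl'⟩ := hsuf
  -- Either the tick completes the transmission of a packet fresh enough, or the destination had one
  -- before.
  rcases hπ.exists_serve_or_arrival r e hh' hl' with ⟨l', h1, h2⟩ | ⟨h'', h1, l', h2, h3⟩
  · refine ⟨l', hul.trans h2, Or.inr ⟨n + 1, (regular_state hz (n + 1)).now_le, ?_⟩⟩
    have hf : π.Fires r (π.state r (commonControl net) z n).1
        (π.stateObs r (commonControl net) z n) :=
      Or.inr ⟨e, he, by simp [h1]⟩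
    rw [state_succ_history, if_pos hf]
    exact Or.inr ⟨e, ⟨he, by simp [h1]⟩, rfl, h1⟩
  · obtain ⟨k, hk, rfl⟩ := exists_history_eq h1
    exact ⟨l', hul.trans h3, Or.inr ⟨k, (regular_state hz k).now_le.trans
      ((strictMono_time hz).monotone (hk.trans n.le_succ)), h2⟩⟩

/-- Under common clocks, whatever a packet delivers at a node by some policy, preemptive LGFS has
delivered something at least as fresh. -/
lemma IsPreemptiveLGFS.hasFresh_of_arrival {R' : Type*} [MeasurableSpace R']
    {π' : CausalPolicy net R'} {r' : R'} (hπ : π.IsPreemptiveLGFS) (hz : ∀ p, 0 < z p)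
    (hd : RowsDiverge z) (n : ℕ) : ∀ {h' : net.History},
      h' <:+ (π'.state r' (commonControl net) z n).1.2 → ∀ {j l}, l ∈ π'.arrivals r' h' j →
        π.HasFresh r z (now h') j (net.s l) := by
  induction n with
  | zero =>
    intro h' hh j l hl
    obtain rfl := List.suffix_nil.1 hh
    exact ⟨l, le_rfl, Or.inl ⟨hl.1, hl.2.le⟩⟩
  | succ n ih =>
    intro h' hh j l hl
    rw [state_succ_history] at hh
    split_ifs at hh with hf
    · rcases List.suffix_cons_iff.1 hh with rfl | hh
      · rcases hl with ⟨rfl, hl⟩ | ⟨e, ⟨he, -⟩, rfl, hs⟩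
        · exact ⟨l, le_rfl, Or.inl ⟨rfl, hl.le⟩⟩
        -- The packet delivered was at the origin at a strictly earlier epoch. By induction LGFS had
        -- a match for it there, and the same tick carries this match across the link.
        · obtain ⟨h', h1, h2⟩ := π'.exists_arrival_of_serve r' hs
          exact hπ.hasFresh_of_tick hz hd (time_mem_ticks hz he)
            ((now_suffix_le hz h1).trans_lt
              ((regular_state (c := commonControl net) hz n).time_lt)) (ih h1 h2)
      · exact ih hh hl
    · exact ih hh hl

end Common

end CausalPolicy

end MultihopAge
end

noncomputable section

namespace MultihopAge

open Network

variable {net : Network} {R : Type*} [MeasurableSpace R]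

namespace CausalPolicy

variable {π : CausalPolicy net R} {r : R}

/-! ### The system driven by its own clocks -/

/-- The transmission times used by the system are the clocks in the `true` rows. -/
def transmissions (z : Clocks net.Link) : net.Link × ℕ → ℝ := fun p => z ((p.1, true), p.2)

variable (π r) in
/-- The `true` rows show the residual transmission times on the busy links and the future
transmission times. -/
structure Tracks (x : net.Link × ℕ → ℝ) (s : (ℝ × net.History) × Clocks net.Link) : Prop where
  busy : ∀ e, π.serve r s.1.2 e ≠ none → s.1.1 + s.2 ((e, true), 0) = π.finish r x s.1.2 e
  busy_succ : ∀ e, π.serve r s.1.2 e ≠ none → ∀ k,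
    s.2 ((e, true), k + 1) = x (e, π.started r s.1.2 e + k)
  idle : ∀ e, π.serve r s.1.2 e = none → ∀ k, s.2 ((e, true), k) = x (e, π.started r s.1.2 e + k)

/-- If the first decision starts a transmission, `started` is already `1` and the head of the row is
the running time; otherwise the whole row lies in the future. -/
lemma tracks_init (z : Clocks net.Link) : π.Tracks r (transmissions z) ((0, []), z) := by
  refine ⟨fun e he => by simp [Rule.finish, transmissions], fun e he k => ?_, fun e he k => ?_⟩
  · have : π.Starts r [] e := (π.starts_iff r [] e).2 ⟨he, he⟩
    simp [Rule.started, this, transmissions, add_comm]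
  · have : ¬ π.Starts r [] e := fun h => ((π.starts_iff r [] e).1 h).1 he
    simp [Rule.started, this, transmissions]

/-- The `true` rows after a decision: links that do not continue a transmission use the next
transmission time. -/
lemma tracks_of_rows {x : net.Link × ℕ → ℝ} {o : net.Obs} {h : net.History} {z' : Clocks net.Link}
    (hcont : ∀ e, π.current r (o :: h) e ≠ none → π.serve r (o :: h) e = π.current r (o :: h) e →
      o.1 + z' ((e, true), 0) = π.finish r x h e ∧
        ∀ k, z' ((e, true), k + 1) = x (e, π.started r h e + k))
    (hnew : ∀ e, (π.current r (o :: h) e = none ∨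
      π.serve r (o :: h) e ≠ π.current r (o :: h) e) →
        ∀ k, z' ((e, true), k) = x (e, π.started r h e + k)) :
    π.Tracks r x ((o.1, o :: h), z') := by
  have hstart : ∀ e, π.Starts r (o :: h) e → π.current r (o :: h) e = none ∨
      π.serve r (o :: h) e ≠ π.current r (o :: h) e := fun e he =>
    Or.inr ((π.starts_iff r _ e).1 he).2
  have hnot : ∀ e, π.serve r (o :: h) e ≠ none → ¬ π.Starts r (o :: h) e →
      π.current r (o :: h) e ≠ none ∧ π.serve r (o :: h) e = π.current r (o :: h) e := by
    intro e h1 h2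
    have h3 : π.serve r (o :: h) e = π.current r (o :: h) e := by
      by_contra h3
      exact h2 ((π.starts_iff r _ e).2 ⟨h1, h3⟩)
    exact ⟨h3 ▸ h1, h3⟩
  refine ⟨fun e he => ?_, fun e he k => ?_, fun e he k => ?_⟩
  · by_cases hS : π.Starts r (o :: h) e
    · have := hnew e (hstart e hS) 0
      simp only [Rule.finish, hS, if_true]
      rw [this, add_zero]
    · obtain ⟨h1, h2⟩ := hnot e he hS
      simp only [Rule.finish, hS, if_false]
      exact (hcont e h1 h2).1
  · by_cases hS : π.Starts r (o :: h) e
    · have := hnew e (hstart e hS) (k + 1)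
      simp only [Rule.started, hS, if_true]
      rw [this]
      congr 2
      ring
    · obtain ⟨h1, h2⟩ := hnot e he hS
      simp only [Rule.started, hS, if_false]
      exact (hcont e h1 h2).2 k
  · have hS : ¬ π.Starts r (o :: h) e := fun hS => ((π.starts_iff r _ e).1 hS).1 he
    simp only [Rule.started, hS, if_false, add_zero]
    refine hnew e ?_ k
    by_cases hc : π.current r (o :: h) e = none
    · exact Or.inl hc
    · exact Or.inr fun h' => hc (h' ▸ he)

/-! ### One race when the system runs on its own clocks -/

section Step

variable {x : net.Link × ℕ → ℝ} {s : (ℝ × net.History) × Clocks net.Link}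

open Classical in
/-- The `true` rows after a race, before the decision at its end. -/
lemma own_raceNext_row (e : net.Link) (D : ℝ) (k : ℕ) :
    raceNext (fun e => (e, (π.ownControl r).sel s.1 e)) D s.2 ((e, true), k) =
      if π.serve r s.1.2 e ≠ none then
        (if e ∈ (raceObs (fun e => (e, (π.ownControl r).sel s.1 e)) D s.2).2 then
          s.2 ((e, true), k + 1)
        else if k = 0 then
          s.2 ((e, true), 0) - (raceObs (fun e => (e, (π.ownControl r).sel s.1 e)) D s.2).1
        else s.2 ((e, true), k))
      else s.2 ((e, true), k) := by
  rw [raceNext_row]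
  have h1 : (π.ownControl r).sel s.1 e = true ↔ π.serve r s.1.2 e ≠ none :=
    Option.isSome_iff_ne_none
  by_cases h : π.serve r s.1.2 e ≠ none
  · rw [if_pos (h1.2 h), if_pos h]
    refine if_congr ?_ rfl rfl
    simp [raceObs, h1.2 h]
  · rw [if_neg (mt h1.1 h), if_neg h]

lemma mem_own_obs_iff (hs : π.Regular r s) {e : net.Link} (he : π.serve r s.1.2 e ≠ none) :
    e ∈ ((π.dynamics r).obs (π.ownControl r) s).2 ↔
      s.2 ((e, true), 0) = ((π.dynamics r).obs (π.ownControl r) s).1 := by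
  have h1 : (π.ownControl r).sel s.1 e = true := Option.isSome_iff_ne_none.2 he
  rw [hs.obs_eq]
  simp [raceObs, h1]

lemma own_obs_le (hs : π.Regular r s) {e : net.Link} (he : π.serve r s.1.2 e ≠ none) :
    ((π.dynamics r).obs (π.ownControl r) s).1 ≤ s.2 ((e, true), 0) := by
  have h1 : (π.ownControl r).sel s.1 e = true := Option.isSome_iff_ne_none.2 he
  rw [hs.obs_eq]
  have := raceTime_le (fun e => (e, (π.ownControl r).sel s.1 e))
    (π.deadline r s.1.2 - s.1.1) s.2 e
  rwa [h1] at this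

/-- On busy links the head of the row is the time left until `finish`, so the first event among
these links and the deadline is the next epoch. Firing ensures that the race was not ended by the
clocks of idle links alone. -/
lemma own_nextObs (hs : π.Regular r s) (ht : π.Tracks r x s)
    (hf : π.Fires r s.1 ((π.dynamics r).obs (π.ownControl r) s)) :
    π.nextObs r x s.1.2 = (s.1.1 + ((π.dynamics r).obs (π.ownControl r) s).1,
      {e | e ∈ ((π.dynamics r).obs (π.ownControl r) s).2 ∧ π.serve r s.1.2 e ≠ none}) := by
  have hle := hs.time_le_deadline (c := π.ownControl r)
  have hn : π.nextTime r x s.1.2 = s.1.1 + ((π.dynamics r).obs (π.ownControl r) s).1 := by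
    refine (π.isLeast_nextTime r x s.1.2).unique ⟨?_, ?_⟩
    · rcases hf with hf | ⟨e, he, hb⟩
      · exact Or.inl hf
      · refine Or.inr ⟨e, hb, ?_⟩
        rw [← ht.busy e hb, (mem_own_obs_iff hs hb).1 he]
    · rintro t (rfl | ⟨e, hb, rfl⟩)
      · exact hle
      · rw [← ht.busy e hb]
        linarith [own_obs_le hs hb]
  refine Prod.ext hn ?_
  ext e
  simp only [Rule.nextObs, Set.mem_ofPred_eq, hn]
  constructor
  · rintro ⟨hb, h⟩
    refine ⟨(mem_own_obs_iff hs hb).2 ?_, hb⟩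
    rw [← ht.busy e hb] at h
    linarith
  · rintro ⟨he, hb⟩
    refine ⟨hb, ?_⟩
    rw [← ht.busy e hb, (mem_own_obs_iff hs hb).1 he]

/-- Without an epoch the residual times on busy links just shrink by the time elapsed. At an epoch a
continued transmission keeps its residual time, the row of a completed or idle link already shows
the next transmission time, and for an interrupted transmission the discard brings it to the head.
-/
lemma Tracks.step (hs : π.Regular r s) (ht : π.Tracks r x s) :
    π.Tracks r x ((π.dynamics r).step (π.ownControl r) s) := by
  classical
  set o := (π.dynamics r).obs (π.ownControl r) s with ho
  have hclk := hs.step_clocks (c := π.ownControl r)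
  have hrow : ∀ e k, raceNext (fun e => (e, (π.ownControl r).sel s.1 e))
      (π.deadline r s.1.2 - s.1.1) s.2 ((e, true), k) =
      if π.serve r s.1.2 e ≠ none then
        (if e ∈ o.2 then s.2 ((e, true), k + 1)
        else if k = 0 then s.2 ((e, true), 0) - o.1 else s.2 ((e, true), k))
      else s.2 ((e, true), k) := by
    intro e k
    rw [own_raceNext_row, ho, hs.obs_eq]
  by_cases hf : π.Fires r s.1 o
  · have hq : ((π.dynamics r).step (π.ownControl r) s).1 =
        (s.1.1 + o.1, (s.1.1 + o.1, {e | e ∈ o.2 ∧ π.serve r s.1.2 e ≠ none}) :: s.1.2) := by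
      change π.nextState r s.1 o = _
      simp [nextState, hf]
    set o' : net.Obs := (s.1.1 + o.1, {e | e ∈ o.2 ∧ π.serve r s.1.2 e ≠ none}) with ho'
    have hstate : (π.nextState r s.1 o).2 = o' :: s.1.2 := by simp [nextState, hf, ho']
    have hdisc : ∀ e, e ∈ (π.ownControl r).disc s.1 o ↔ π.current r (o' :: s.1.2) e ≠ none ∧
        π.serve r (o' :: s.1.2) e ≠ π.current r (o' :: s.1.2) e := by
      intro e
      simp only [ownControl, Set.mem_ofPred_eq, hstate, hf, true_and]
    have hz' : ∀ e k, ((π.dynamics r).step (π.ownControl r) s).2 ((e, true), k) =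
        if e ∈ (π.ownControl r).disc s.1 o then
          raceNext (fun e => (e, (π.ownControl r).sel s.1 e))
            (π.deadline r s.1.2 - s.1.1) s.2 ((e, true), k + 1)
        else raceNext (fun e => (e, (π.ownControl r).sel s.1 e))
            (π.deadline r s.1.2 - s.1.1) s.2 ((e, true), k) := by
      intro e k
      rw [hclk, ← ho]
      simp [dropRows]
    have hcur : ∀ e, π.current r (o' :: s.1.2) e ≠ none →
        e ∉ o.2 ∧ π.serve r s.1.2 e ≠ none := by
      intro e hc
      simp only [Rule.current] at hc
      split_ifs at hc with he
      · exact absurd rfl hc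
      · exact ⟨fun h => he ⟨h, hc⟩, hc⟩
    have key := tracks_of_rows (π := π) (r := r) (x := x) (o := o') (h := s.1.2)
      (z' := ((π.dynamics r).step (π.ownControl r) s).2) (fun e hc hsv => ?_) (fun e hc k => ?_)
    · have : (π.dynamics r).step (π.ownControl r) s =
          ((o'.1, o' :: s.1.2), ((π.dynamics r).step (π.ownControl r) s).2) := Prod.ext hq rfl
      rw [this]
      exact key
    · obtain ⟨h1, h2⟩ := hcur e hc
      have hnd : e ∉ (π.ownControl r).disc s.1 o := fun h => ((hdisc e).1 h).2 hsv
      constructor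
      · rw [hz', if_neg hnd, hrow, if_pos h2, if_neg h1, if_pos rfl, ← ht.busy e h2]
        simp [ho']
      · intro k
        rw [hz', if_neg hnd, hrow, if_pos h2, if_neg h1, if_neg (Nat.succ_ne_zero k),
          ht.busy_succ e h2]
    · by_cases hcn : π.current r (o' :: s.1.2) e = none
      · have hnd : e ∉ (π.ownControl r).disc s.1 o := fun h => ((hdisc e).1 h).1 hcn
        rw [hz', if_neg hnd, hrow]
        by_cases hb : π.serve r s.1.2 e ≠ none
        · have he : e ∈ o.2 := by
            by_contra he
            have : e ∉ o'.2 := fun h => he h.1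
            simp only [Rule.current, this, if_false] at hcn
            exact hb hcn
          rw [if_pos hb, if_pos he, ht.busy_succ e hb]
        · rw [if_neg hb, ht.idle e (not_not.1 hb)]
      · obtain ⟨h1, h2⟩ := hcur e hcn
        have hd : e ∈ (π.ownControl r).disc s.1 o :=
          (hdisc e).2 ⟨hcn, hc.resolve_left hcn⟩
        rw [hz', if_pos hd, hrow, if_pos h2, if_neg h1, if_neg (Nat.succ_ne_zero k),
          ht.busy_succ e h2]
  · have hq : ((π.dynamics r).step (π.ownControl r) s).1 = (s.1.1 + o.1, s.1.2) := by
      change π.nextState r s.1 o = _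
      simp [nextState, hf]
    have hz' : ∀ e k, ((π.dynamics r).step (π.ownControl r) s).2 ((e, true), k) =
        raceNext (fun e => (e, (π.ownControl r).sel s.1 e))
            (π.deadline r s.1.2 - s.1.1) s.2 ((e, true), k) := by
      intro e k
      have : e ∉ (π.ownControl r).disc s.1 o := fun h => hf h.1
      rw [hclk, ← ho]
      simp [dropRows, this]
    have hno : ∀ e, π.serve r s.1.2 e ≠ none → e ∉ o.2 := fun e hb he => hf (Or.inr ⟨e, he, hb⟩)
    refine ⟨fun e he => ?_, fun e he k => ?_, fun e he k => ?_⟩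
    · rw [hz', hq] at *
      rw [hrow, if_pos he, if_neg (hno e he), if_pos rfl, ← ht.busy e he]
      ring
    · rw [hq] at he
      rw [hz', hq, hrow, if_pos he, if_neg (hno e he), if_neg (Nat.succ_ne_zero k),
        ht.busy_succ e he]
    · rw [hq] at he
      rw [hz', hq, hrow, if_neg (not_not.2 he), ht.idle e he]

end Step

variable {z : Clocks net.Link}

lemma tracks_state (hz : ∀ p, 0 < z p) (n : ℕ) :
    π.Tracks r (transmissions z) (π.state r (π.ownControl r) z n) := by
  induction n with
  | zero => exact tracks_init z
  | succ n ih => exact ih.step (regular_state hz n)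

lemma own_history_succ (hz : ∀ p, 0 < z p) {n : ℕ} (hf : π.Fires r
      (π.state r (π.ownControl r) z n).1 (π.stateObs r (π.ownControl r) z n)) :
    (π.state r (π.ownControl r) z (n + 1)).1.2 =
      π.nextObs r (transmissions z) (π.state r (π.ownControl r) z n).1.2 ::
        (π.state r (π.ownControl r) z n).1.2 := by
  rw [own_nextObs (regular_state hz n) (tracks_state hz n) hf, state_succ_history, if_pos hf]
  rfl

/-- The histories of the clock-driven system are those of the system. -/
lemma exists_run_eq (hz : ∀ p, 0 < z p) (n : ℕ) :
    ∃ m, (π.state r (π.ownControl r) z n).1.2 = π.run (r, transmissions z) m := by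
  induction n with
  | zero => exact ⟨0, rfl⟩
  | succ n ih =>
    obtain ⟨m, hm⟩ := ih
    by_cases hf : π.Fires r (π.state r (π.ownControl r) z n).1 (π.stateObs r (π.ownControl r) z n)
    · exact ⟨m + 1, by rw [own_history_succ hz hf, hm]; rfl⟩
    · exact ⟨m, by rw [state_succ_history, if_neg hf, hm]⟩

lemma rowsDiverge_state {c : Control (ℝ × net.History) net.Link} (hz : ∀ p, 0 < z p)
    (hd : RowsDiverge z) (n : ℕ) : RowsDiverge (π.state r c z n).2 := by
  induction n with
  | zero => exact hd
  | succ n ih =>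
    have := (regular_state (π := π) (r := r) (c := c) hz n).step_clocks (c := c)
    exact this ▸ rowsDiverge_dropRows (rowsDiverge_raceNext ih)

/-- Every history of the system is a history of the clock-driven system. -/
lemma exists_state_eq_run (hz : ∀ p, 0 < z p) (hd : RowsDiverge z) (m : ℕ) :
    ∃ n, (π.state r (π.ownControl r) z n).1.2 = π.run (r, transmissions z) m := by
  induction m with
  | zero => exact ⟨0, rfl⟩
  | succ m ih =>
    obtain ⟨n₀, h₀⟩ := ih
    -- If no further epoch came, the history would stay fixed and every later race would be ended by
    -- the clock of an idle link before one fixed deadline, whereas only finitely many such ticks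
    -- exist.
    by_contra! hcon
    have hno : ∀ n, (π.state r (π.ownControl r) z n).1.2 = π.run (r, transmissions z) m →
        ¬ π.Fires r (π.state r (π.ownControl r) z n).1 (π.stateObs r (π.ownControl r) z n) :=
      fun n hn hf => hcon (n + 1) (by rw [own_history_succ hz hf, hn]; rfl)
    have hconst : ∀ n, n₀ ≤ n →
        (π.state r (π.ownControl r) z n).1.2 = π.run (r, transmissions z) m := by
      intro n hn
      induction n, hn using Nat.le_induction with
      | base => exact h₀
      | succ n _ ih => rw [state_succ_history, if_neg (hno n ih), ih]
    set h := π.run (r, transmissions z) m with hh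
    have hsel : ∀ n, n₀ ≤ n → ∀ e, π.serve r h e = none →
        (π.ownControl r).sel (π.state r (π.ownControl r) z n).1 e = false := by
      intro n hn e he
      change (π.serve r (π.state r (π.ownControl r) z n).1.2 e).isSome = false
      rw [hconst n hn, he]
      rfl
    have hobs : ∀ n, π.stateObs r (π.ownControl r) z n =
        raceObs (fun e => (e, (π.ownControl r).sel (π.state r (π.ownControl r) z n).1 e))
          (π.deadline r (π.state r (π.ownControl r) z n).1.2 -
            (π.state r (π.ownControl r) z n).1.1) (π.state r (π.ownControl r) z n).2 := fun n =>
      (regular_state hz n).obs_eq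
    -- While a link stays idle its `false` row runs without interruption, as discards touch `true`
    -- rows only.
    have hticks : ∀ n, n₀ ≤ n → ∀ e, π.serve r h e = none → ∀ T,
        T ∈ ticks (π.state r (π.ownControl r) z n).1.1
          (π.state r (π.ownControl r) z n).2 (e, false) →
        T ∈ ticks (π.state r (π.ownControl r) z n₀).1.1
          (π.state r (π.ownControl r) z n₀).2 (e, false) := by
      intro n hn e he T
      induction n, hn using Nat.le_induction with
      | base => exact id
      | succ n hn ih =>
        intro hT
        refine ih ?_
        have hstep : (π.state r (π.ownControl r) z (n + 1)).2 = _ :=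
          (regular_state (π := π) (r := r) (c := π.ownControl r) hz n).step_clocks
        have hs := hsel n hn e he
        have := mem_ticks_of_mem_ticks_race (T := T) (e := e)
          (s := fun e => (π.ownControl r).sel (π.state r (π.ownControl r) z n).1 e)
          (D := π.deadline r (π.state r (π.ownControl r) z n).1.2 -
            (π.state r (π.ownControl r) z n).1.1) (t := (π.state r (π.ownControl r) z n).1.1)
          (z := (π.state r (π.ownControl r) z n).2)
          (z' := (π.state r (π.ownControl r) z (n + 1)).2)
          (fun k => by rw [hstep]; simp [dropRows, hs])
        rw [hs] at this
        refine this ?_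
        rw [time_succ, hobs] at hT
        exact hT
    let F : Set ℝ := ⋃ e : net.Link, {T | T ∈ ticks (π.state r (π.ownControl r) z n₀).1.1
          (π.state r (π.ownControl r) z n₀).2 (e, false) ∧ T ≤ π.deadline r h}
    have hF : F.Finite := Set.finite_iUnion fun e =>
      finite_ticks_le (regular_state hz n₀).pos (rowsDiverge_state hz hd n₀) _
    refine not_strictMono_of_finite
      (strictMono_time (π := π) (r := r) (c := π.ownControl r) hz) hF (n₀ := n₀ + 1) fun n hn => ?_
    obtain ⟨n, rfl⟩ := Nat.exists_eq_add_of_le' (Nat.one_le_of_lt hn)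
    have hn : n₀ ≤ n := Nat.le_of_succ_le_succ hn
    have hnf := hno n (hconst n hn)
    have hreg := regular_state (π := π) (r := r) (c := π.ownControl r) hz n
    have hle : (π.state r (π.ownControl r) z (n + 1)).1.1 ≤ π.deadline r h :=
      hconst n hn ▸ hreg.time_le_deadline (c := π.ownControl r)
    obtain ⟨e, he⟩ : ∃ e, e ∈ (π.stateObs r (π.ownControl r) z n).2 := by
      rw [hobs]
      rcases raceTime_eq
        (fun e => (e, (π.ownControl r).sel (π.state r (π.ownControl r) z n).1 e))
        (π.deadline r (π.state r (π.ownControl r) z n).1.2 -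
            (π.state r (π.ownControl r) z n).1.1) (π.state r (π.ownControl r) z n).2 with hD | ⟨e, hD⟩
      · refine absurd (Or.inl ?_) hnf
        rw [hobs]
        simp only [raceObs, hD]
        ring
      · exact ⟨e, hD.symm⟩
    have hidle : π.serve r h e = none := by
      by_contra hb
      exact hnf (Or.inr ⟨e, he, by rwa [hconst n hn]⟩)
    refine Set.mem_iUnion.2 ⟨e, hticks n hn e hidle _ ?_, hle⟩
    rw [time_succ, hobs]
    rw [hobs] at he
    have := mem_ticks_of_mem_raceObs (t := (π.state r (π.ownControl r) z n).1.1)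
      (s := fun e => (π.ownControl r).sel (π.state r (π.ownControl r) z n).1 e) he
    rwa [hsel n hn e hidle] at this

end CausalPolicy

end MultihopAge
end

noncomputable section

namespace MultihopAge

open Network

variable {net : Network} {R R' : Type*} [MeasurableSpace R] [MeasurableSpace R']

namespace CausalPolicy

variable {π : CausalPolicy net R} {r : R} {z : Clocks net.Link}

/-! ### Comparison of the ages -/

lemma now_suffix_le_now {c : Control (ℝ × net.History) net.Link} (hz : ∀ p, 0 < z p) {n : ℕ}
    {h' : net.History} (hh : h' <:+ (π.state r c z n).1.2) :
    now h' ≤ now (π.state r c z n).1.2 := by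
  induction n with
  | zero => rw [List.suffix_nil.1 hh]; exact le_rfl
  | succ n ih =>
    rw [state_succ_history] at hh ⊢
    split_ifs at hh ⊢ with hf
    · rcases List.suffix_cons_iff.1 hh with rfl | hh
      · exact le_rfl
      · exact (ih hh).trans ((regular_state hz n).now_le.trans
          ((strictMono_time hz).monotone n.le_succ))
    · exact ih hh

variable (π r) in
/-- Every packet has come from the gateway. -/
lemma exists_gateway_arrival {l : ℕ} (h : net.History) : ∀ {j : net.Node},
    l ∈ π.arrivals r h j → ∃ h', h' <:+ h ∧ now h' = net.a l := by
  -- Tracing the packet back over a link leads to some shorter history, not necessarily the tail,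
  -- hence strong induction.
  induction hn : h.length using Nat.strong_induction_on generalizing h with
  | _ n ih =>
    intro j hl
    subst hn
    cases h with
    | nil => exact ⟨[], List.suffix_rfl, hl.2.symm⟩
    | cons o h =>
      rcases hl with ⟨-, hl⟩ | ⟨e, -, -, hs⟩
      · exact ⟨o :: h, List.suffix_rfl, hl.symm⟩
      · obtain ⟨h₁, h2, h3⟩ := π.exists_arrival_of_serve r hs
        obtain ⟨h', h4, h5⟩ := ih h₁.length
          (h2.length_le.trans_lt (by simp)) h₁ rfl h3
        exact ⟨h', h4.trans (h2.trans (List.suffix_cons o h)), h5⟩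

/-- Needed so that the supremum in `freshest` is taken over a bounded set: generation times of
arrived packets do not exceed `t`. -/
lemma arrival_le_of_arrivedBy (hz : ∀ p, 0 < z p) (hd : RowsDiverge z) {t : ℝ} {j : net.Node}
    {l : ℕ} (h : π.ArrivedBy (r, transmissions z) t j l) : net.a l ≤ t := by
  rcases h with ⟨-, h⟩ | ⟨m, hm, hl⟩
  · exact h
  · obtain ⟨n, hn⟩ := exists_state_eq_run (π := π) (r := r) hz hd m
    rw [← hn] at hm hl
    obtain ⟨h', h1, h2⟩ := π.exists_gateway_arrival r _ hl
    exact h2 ▸ (now_suffix_le_now hz h1).trans hm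

/-- If a preemptive LGFS policy and another policy see the same expiries of clocks then the ages
under the former are smaller. -/
lemma IsPreemptiveLGFS.age_le {π' : CausalPolicy net R'} {r' : R'} (hπ : π.IsPreemptiveLGFS)
    {a b w : Clocks net.Link} (ha : ∀ p, 0 < a p) (ha' : RowsDiverge a) (hb : ∀ p, 0 < b p)
    (hb' : RowsDiverge b) (hw : ∀ p, 0 < w p) (hw' : RowsDiverge w)
    (h : (π.dynamics r).path (π.ownControl r) (0, []) a =
      (π.dynamics r).path (commonControl net) (0, []) w)
    (h' : (π'.dynamics r').path (π'.ownControl r') (0, []) b =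
      (π'.dynamics r').path (commonControl net) (0, []) w) :
    π.age (r, transmissions a) ≤ π'.age (r', transmissions b) := by
  have hh : ∀ n, (π.state r (π.ownControl r) a n).1 = (π.state r (commonControl net) w n).1 :=
    fun n => congrFun h n
  have hh' : ∀ n, (π'.state r' (π'.ownControl r') b n).1 =
      (π'.state r' (commonControl net) w n).1 := fun n => congrFun h' n
  intro t j
  have hbdd : BddAbove (insert 0 {u | ∃ l, π.ArrivedBy (r, transmissions a) t j l ∧
      net.s l = u}) := by
    refine ⟨t, ?_⟩
    rintro _ (rfl | ⟨l, hl, rfl⟩)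
    · exact t.2
    · exact (net.s_le_a l).trans (arrival_le_of_arrivedBy ha ha' hl)
  refine sub_le_sub_left (csSup_le (Set.insert_nonempty _ _) ?_) _
  rintro _ (rfl | ⟨l, hl, rfl⟩)
  · exact le_csSup hbdd (Set.mem_insert _ _)
  have hfresh : π.HasFresh r w t j (net.s l) := by
    rcases hl with hl | ⟨m, hm, hl⟩
    · exact ⟨l, le_rfl, Or.inl hl⟩
    -- A delivery of the other policy is moved from its real system to its own clocks and, by
    -- equality of the paths, to the common clocks, where LGFS has a match.
    · obtain ⟨n, hn⟩ := exists_state_eq_run (π := π') (r := r') hb hb' m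
      rw [← hn, hh'] at hm hl
      obtain ⟨l', h1, h2⟩ := hπ.hasFresh_of_arrival (r := r) hw hw' n List.suffix_rfl hl
      refine ⟨l', h1, ?_⟩
      rcases h2 with ⟨h2, h3⟩ | ⟨k, h2, h3⟩
      · exact Or.inl ⟨h2, h3.trans hm⟩
      · exact Or.inr ⟨k, h2.trans hm, h3⟩
  obtain ⟨l', h1, h2⟩ := hfresh
  refine h1.trans (le_csSup hbdd (Set.mem_insert_of_mem _ ⟨l', ?_, rfl⟩))
  rcases h2 with h2 | ⟨n, h2, h3⟩
  · exact Or.inl h2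
  -- The match is brought back from the common clocks to the real system of the LGFS policy.
  · obtain ⟨m, hm⟩ := exists_run_eq (π := π) (r := r) ha n
    rw [← hh, hm] at h2 h3
    exact Or.inr ⟨m, h2, h3⟩

/-! ### The coupling of the transmission times -/

lemma clockLaw_map_transmissions (rate : net.Link → ℝ) (hrate : ∀ e, 0 < rate e) :
    (clockLaw rate hrate).map transmissions = transmissionLaw rate hrate :=
  rowLaw_map_comp_injective (fun c : net.Link × Bool => rate c.1) _ rate hrate
    (σ := fun p : net.Link × ℕ => ((p.1, true), p.2))
    (fun p q h => by simpa [Prod.ext_iff] using h) fun p => rfl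

lemma measurable_transmissions : Measurable (transmissions : Clocks net.Link → _) := by
  unfold transmissions; fun_prop

instance (net : Network) : MeasurableEq (Set net.Link) := inferInstance

instance (net : Network) : MeasurableEq net.Obs := inferInstance

/-- The transmission times under a preemptive LGFS policy and under another policy can be coupled
in such a way that the ages are ordered almost surely. -/
theorem IsPreemptiveLGFS.exists_coupling (hπ : π.IsPreemptiveLGFS) (r : R)
    (π' : CausalPolicy net R') (r' : R') (rate : net.Link → ℝ) (hrate : ∀ e, 0 < rate e) :
    ∃ (γ : Measure ((Clocks net.Link × Clocks net.Link) × (Clocks net.Link × Clocks net.Link)))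
      (X Y : _ → net.Link × ℕ → ℝ), MeasurePreserving X γ (transmissionLaw rate hrate) ∧
      MeasurePreserving Y γ (transmissionLaw rate hrate) ∧
      ∀ᵐ w ∂γ, π.age (r, X w) ≤ π'.age (r', Y w) := by
  set T := clockLaw rate hrate with hT
  -- In `γ₁`, and likewise in `γ₂` for the other policy, the first component runs under the own
  -- control and the second one under the common control, along the same path.
  obtain ⟨γ₁, _, h₁, h₁', e₁⟩ := MultihopAge.exists_coupling T T
    ((π.dynamics r).measurable_path (π.ownControl r) (0, []))
    ((π.dynamics r).measurable_path (commonControl net) (0, []))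
    ((π.dynamics r).map_path_eq rate hrate _ _ _)
  obtain ⟨γ₂, _, h₂, h₂', e₂⟩ := MultihopAge.exists_coupling T T
    ((π'.dynamics r').measurable_path (π'.ownControl r') (0, []))
    ((π'.dynamics r').measurable_path (commonControl net) (0, []))
    ((π'.dynamics r').map_path_eq rate hrate _ _ _)
  -- Gluing along the second components makes both policies see the same common clocks.
  obtain ⟨γ, _, h₃, h₃', e₃⟩ := MultihopAge.exists_coupling γ₁ γ₂
    (measurable_snd (α := Clocks net.Link) (β := Clocks net.Link))
    (measurable_snd (α := Clocks net.Link) (β := Clocks net.Link)) (h₁'.trans h₂'.symm)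
  have good : ∀ᵐ z ∂T, (∀ p, 0 < z p) ∧ RowsDiverge z :=
    (ae_pos_rowLaw _ _).and (ae_rowsDiverge _ _)
  have m1 : Measurable fun x : (Clocks net.Link × Clocks net.Link) ×
      (Clocks net.Link × Clocks net.Link) => transmissions x.1.1 :=
    measurable_transmissions.comp (by fun_prop)
  have m2 : Measurable fun x : (Clocks net.Link × Clocks net.Link) ×
      (Clocks net.Link × Clocks net.Link) => transmissions x.2.1 :=
    measurable_transmissions.comp (by fun_prop)
  have q1 : ∀ᵐ x ∂γ, (∀ p, 0 < x.1.1 p) ∧ RowsDiverge x.1.1 := by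
    rw [← h₁] at good
    have := ae_of_ae_map (by fun_prop) good
    rw [← h₃] at this
    exact ae_of_ae_map (by fun_prop) this
  have q2 : ∀ᵐ x ∂γ, (∀ p, 0 < x.1.2 p) ∧ RowsDiverge x.1.2 := by
    rw [← h₁'] at good
    have := ae_of_ae_map (by fun_prop) good
    rw [← h₃] at this
    exact ae_of_ae_map (by fun_prop) this
  have q3 : ∀ᵐ x ∂γ, (∀ p, 0 < x.2.1 p) ∧ RowsDiverge x.2.1 := by
    rw [← h₂] at good
    have := ae_of_ae_map (by fun_prop) good
    rw [← h₃'] at this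
    exact ae_of_ae_map (by fun_prop) this
  rw [← h₃] at e₁
  rw [← h₃'] at e₂
  have e₁' := ae_of_ae_map (by fun_prop) e₁
  have e₂' := ae_of_ae_map (by fun_prop) e₂
  have mt := measurable_transmissions (net := net)
  refine ⟨γ, fun x => transmissions x.1.1, fun x => transmissions x.2.1, ⟨m1, ?_⟩, ⟨m2, ?_⟩, ?_⟩
  · rw [← clockLaw_map_transmissions, ← hT, ← h₁, ← h₃, Measure.map_map (by fun_prop) (by fun_prop),
      Measure.map_map (by fun_prop) (by fun_prop)]
    rfl
  · rw [← clockLaw_map_transmissions, ← hT, ← h₂, ← h₃', Measure.map_map (by fun_prop) (by fun_prop),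
      Measure.map_map (by fun_prop) (by fun_prop)]
    rfl
  · filter_upwards [q1, q2, q3, e₁', e₂', e₃] with x q1 q2 q3 e₁ e₂ e₃
    rw [← e₃] at e₂
    exact hπ.age_le q1.1 q1.2 q3.1 q3.2 q2.1 q2.2 e₁ e₂

end CausalPolicy

end MultihopAge
end

noncomputable section

namespace MultihopAge

open Network

/-! ### Existence of preemptive LGFS policies -/

/-- The decision of a preemptive LGFS policy: among the packets in transmission (`cur`) and further
available packets (`B`) serve a freshest one, and store the other ones as long as there is room. -/
lemma exists_decision (s : ℕ → ℝ) (cur : Option ℕ) (B : Finset ℕ) (b : ℕ∞) :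
    ∃ d : Option ℕ × Finset ℕ,
      (∀ l, d.1 = some l → l ∈ cur.toFinset ∪ B) ∧ (d.1 = none → cur.toFinset ∪ B = ∅) ∧
      (∀ l, d.1 = some l → ∀ l' ∈ cur.toFinset ∪ B, s l' ≤ s l) ∧
      (∀ c, cur = some c → (∀ l' ∈ cur.toFinset ∪ B, s l' ≤ s c) → d.1 = some c) ∧
      d.2 ⊆ cur.toFinset ∪ B ∧ (∀ l ∈ d.2, d.1 ≠ some l) ∧ (d.2.card : ℕ∞) ≤ b ∧
      ∀ l ∈ cur.toFinset ∪ B, d.1 ≠ some l → l ∉ d.2 → (d.2.card : ℕ∞) = b := by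
  set A := cur.toFinset ∪ B with hA
  rcases A.eq_empty_or_nonempty with h | h
  · refine ⟨(none, ∅), by simp, fun _ => h, by simp, ?_, by simp, by simp, by simp, by simp [h]⟩
    rintro c rfl
    have : c ∈ A := by simp [hA]
    simp [h] at this
  obtain ⟨m, hm, hmax, hc⟩ : ∃ m ∈ A, (∀ l' ∈ A, s l' ≤ s m) ∧
      ∀ c, cur = some c → (∀ l' ∈ A, s l' ≤ s c) → m = c := by
    -- The packet in transmission wins ties, so that it is never preempted needlessly.
    by_cases hcur : ∃ c, cur = some c ∧ ∀ l' ∈ A, s l' ≤ s c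
    · obtain ⟨c, rfl, hc⟩ := hcur
      exact ⟨c, by simp [hA], hc, fun c' h _ => Option.some.inj h⟩
    · obtain ⟨m, hm, hmax⟩ := A.exists_max_image s h
      exact ⟨m, hm, hmax, fun c h1 h2 => absurd ⟨c, h1, h2⟩ hcur⟩
  -- Store all the other packets if they fit; otherwise `b` is finite and any `b` of them fill the
  -- buffer.
  obtain ⟨F, hF, hcard, hfull⟩ : ∃ F ⊆ A.erase m, (F.card : ℕ∞) ≤ b ∧
      (F = A.erase m ∨ (F.card : ℕ∞) = b) := by
    rcases le_or_gt ((A.erase m).card : ℕ∞) b with hb | hb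
    · exact ⟨_, subset_rfl, hb, Or.inl rfl⟩
    · lift b to ℕ using hb.ne_top
      obtain ⟨F, h1, h2⟩ := Finset.exists_subset_card_eq (Nat.cast_lt.1 hb).le
      exact ⟨F, h1, by simp [h2], Or.inr (by simp [h2])⟩
  refine ⟨(some m, F), ?_, by simp, ?_, ?_, hF.trans (A.erase_subset m), ?_, hcard, ?_⟩
  · rintro l h
    exact Option.some.inj h ▸ hm
  · rintro l h
    exact Option.some.inj h ▸ hmax
  · intro c h1 h2
    rw [hc c h1 h2]
  · rintro l hl h
    exact Finset.ne_of_mem_erase (hF hl) (Option.some.inj h).symm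
  · intro l hl h1 h2
    refine hfull.resolve_left ?_
    rintro rfl
    exact h2 (Finset.mem_erase.2 ⟨fun h => h1 (h ▸ rfl), hl⟩)

/-- The packet served and the packets stored by a preemptive LGFS policy. -/
def decision (s : ℕ → ℝ) (cur : Option ℕ) (B : Finset ℕ) (b : ℕ∞) : Option ℕ × Finset ℕ :=
  (exists_decision s cur B b).choose

variable (net : Network)

/-- The packets that arrive at the gateway at time `t`. -/
def Network.arrivingAt (t : ℝ) : Finset ℕ :=
  ((net.finite_arrivals t).subset fun _ h => le_of_eq h : {l | net.a l = t}.Finite).toFinset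

variable {net} in
@[simp] lemma Network.mem_arrivingAt {t : ℝ} {l : ℕ} : l ∈ net.arrivingAt t ↔ net.a l = t := by
  simp [arrivingAt]

open Classical in
/-- The decisions of a preemptive LGFS policy at an epoch with completions `E` and arrivals `F` at
the gateway, given its previous decisions `w`. -/
def lgfsStep (E : Set net.Link) (F : Finset ℕ) (w : net.Link → Option ℕ × Finset ℕ)
    (e : net.Link) : Option ℕ × Finset ℕ :=
  decision net.s (if e ∈ E then none else (w e).1)
    ((w e).2 ∪ ((if e.1.1 = 0 then F else ∅) ∪
      {e' | e' ∈ E ∧ e'.1.2 = e.1.1}.toFinset.biUnion fun e' => (w e').1.toFinset))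
    (net.buffer e)

/-- The decisions of a preemptive LGFS policy. -/
def lgfs : net.History → net.Link → Option ℕ × Finset ℕ
  | [] => lgfsStep net ∅ (net.arrivingAt 0) fun _ => (none, ∅)
  | o :: h => lgfsStep net o.2 (net.arrivingAt o.1) (lgfs h)

/-- Completions, gateway arrivals and previous decisions take countably many values, so the event
splits into countably many pieces. The decisions of all links are treated jointly because the
arrivals at a node depend on what other links transmitted. -/
lemma measurableSet_lgfs (n : ℕ) (v : net.Link → Option ℕ × Finset ℕ) :
    MeasurableSet {x : Fin n → net.Obs | lgfs net (List.ofFn x) = v} := by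
  induction n generalizing v with
  | zero => simp only [List.ofFn_zero, MeasurableSet.const]
  | succ n ih =>
    have key : {x : Fin (n + 1) → net.Obs | lgfs net (List.ofFn x) = v} =
        ⋃ (E : Set net.Link) (F : Finset ℕ) (w) (_ : lgfsStep net E F w = v),
          {x | (x 0).2 = E} ∩ {x | net.arrivingAt (x 0).1 = F} ∩
            (fun x i => x (Fin.succ i)) ⁻¹' {x : Fin n → net.Obs | lgfs net (List.ofFn x) = w} := by
      ext x
      simp only [Set.mem_ofPred_eq, List.ofFn_succ, lgfs, Set.mem_iUnion, Set.mem_inter_iff,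
        Set.mem_preimage]
      constructor
      · exact fun h => ⟨_, _, _, h, ⟨rfl, rfl⟩, rfl⟩
      · rintro ⟨_, _, _, h, ⟨rfl, rfl⟩, rfl⟩
        exact h
    rw [key]
    refine MeasurableSet.iUnion fun E => MeasurableSet.iUnion fun F => MeasurableSet.iUnion fun w =>
      MeasurableSet.iUnion fun _ => (MeasurableSet.inter ?_ ?_).inter ?_
    · exact (by fun_prop : Measurable fun x : Fin (n + 1) → net.Obs => (x 0).2)
        (measurableSet_singleton E)
    · have : {x : Fin (n + 1) → net.Obs | net.arrivingAt (x 0).1 = F} =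
          ⋂ l, {x | net.a l = (x 0).1 ↔ l ∈ F} := by
        ext x
        simp [Finset.ext_iff]
      rw [this]
      refine MeasurableSet.iInter fun l => ?_
      refine Measurable.setOf (Measurable.iff ?_ measurable_const)
      exact Measurable.eq measurable_const (by fun_prop)
    · exact (ih w).preimage (by fun_prop)

lemma measurableSet_lgfs_mem (n : ℕ) (e : net.Link) (S : Set (Option ℕ × Finset ℕ)) :
    MeasurableSet {q : Unit × (Fin n → net.Obs) | lgfs net (List.ofFn q.2) e ∈ S} := by
  have key : {q : Unit × (Fin n → net.Obs) | lgfs net (List.ofFn q.2) e ∈ S} =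
      Prod.snd ⁻¹' ⋃ (v : net.Link → Option ℕ × Finset ℕ) (_ : v e ∈ S),
        {x : Fin n → net.Obs | lgfs net (List.ofFn x) = v} := by
    ext q
    simp
  rw [key]
  exact measurable_snd (MeasurableSet.iUnion fun v => MeasurableSet.iUnion fun _ =>
    measurableSet_lgfs net n v)

/-- The control rule of a preemptive LGFS policy. -/
def lgfsRule : Rule net Unit where
  serve _ h e := (lgfs net h e).1
  queue _ h e := (lgfs net h e).2
  timer _ _ := ⊤

/-- `B` collects the queue and all new arrivals, repeated copies included: this policy treats every
arrival as a candidate. -/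
lemma lgfs_eq_decision (r : Unit) (h : net.History) (e : net.Link) :
    ∃ B : Finset ℕ, lgfs net h e =
        decision net.s ((lgfsRule net).current r h e) B (net.buffer e) ∧
      (lgfsRule net).available r h e =
        ↑(((lgfsRule net).current r h e).toFinset ∪ B) := by
  cases h with
  | nil =>
    refine ⟨_, (by simp only [lgfs, lgfsStep, Rule.current, ite_self]; rfl), ?_⟩
    ext l
    simp [Rule.available, Rule.current, Rule.waiting, Rule.arrivals]
    split_ifs with h0 <;> simp [h0]
  | cons o h =>
    refine ⟨_, rfl, ?_⟩
    ext l
    simp only [Rule.available, Rule.waiting, Rule.arrivals, Finset.coe_union, Set.mem_ofPred_eq,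
      Set.mem_union, Finset.mem_coe, Option.mem_toFinset, Option.mem_def]
    refine or_congr Iff.rfl (or_congr Iff.rfl ?_)
    refine or_congr ?_ ?_
    · split_ifs with h0 <;> simp [h0]
    · simp only [Finset.mem_biUnion, Set.mem_toFinset, Set.mem_ofPred_eq, Option.mem_toFinset,
        Option.mem_def, and_assoc]
      rfl

lemma lgfsRule_spec (r : Unit) (h : net.History) (e : net.Link) :
    (∀ l, (lgfsRule net).serve r h e = some l → l ∈ (lgfsRule net).available r h e) ∧
    ((lgfsRule net).serve r h e = none → (lgfsRule net).available r h e = ∅) ∧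
    (∀ l, (lgfsRule net).serve r h e = some l →
      ∀ l' ∈ (lgfsRule net).available r h e, net.s l' ≤ net.s l) ∧
    (∀ c, (lgfsRule net).current r h e = some c →
      (∀ l' ∈ (lgfsRule net).available r h e, net.s l' ≤ net.s c) →
        (lgfsRule net).serve r h e = some c) ∧
    (∀ l ∈ (lgfsRule net).queue r h e, l ∈ (lgfsRule net).available r h e) ∧
    (∀ l ∈ (lgfsRule net).queue r h e, (lgfsRule net).serve r h e ≠ some l) ∧
    (((lgfsRule net).queue r h e).card : ℕ∞) ≤ net.buffer e ∧
    ∀ l ∈ (lgfsRule net).available r h e, (lgfsRule net).serve r h e ≠ some l →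
      l ∉ (lgfsRule net).queue r h e → (((lgfsRule net).queue r h e).card : ℕ∞) = net.buffer e := by
  obtain ⟨B, h1, h2⟩ := lgfs_eq_decision net r h e
  have := (exists_decision net.s ((lgfsRule net).current r h e) B (net.buffer e)).choose_spec
  change _ ∧ _ ∧ _ ∧ _ ∧ _ ∧ _ ∧ _ ∧ _ at this
  rw [h2]
  have h3 : (lgfsRule net).serve r h e = (lgfs net h e).1 := rfl
  have h4 : (lgfsRule net).queue r h e = (lgfs net h e).2 := rfl
  rw [h3, h4, h1]
  simp only [Finset.mem_coe, Finset.coe_eq_empty]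
  exact this

/-- Properties established for all available packets thereby cover the contenders, and the essential
packets among them. -/
lemma contenders_lgfsRule_subset (r : Unit) (h : net.History) (e : net.Link) :
    (lgfsRule net).contenders r h e ⊆ (lgfsRule net).available r h e := by
  rintro l ((h1 | h1 | h1) | h1 | h1)
  · exact Or.inl h1
  · exact Or.inr (Or.inl h1)
  · exact Or.inr (Or.inr h1.1)
  · exact (lgfsRule_spec net r h e).2.2.2.2.1 l h1
  · exact (lgfsRule_spec net r h e).1 l h1

/-- A preemptive LGFS policy. -/
def lgfsPolicy : CausalPolicy net Unit where
  toRule := lgfsRule net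
  measurable_serve n e p := measurableSet_lgfs_mem net n e {d | d.1 = p}
  measurable_queue n e F := measurableSet_lgfs_mem net n e {d | d.2 = F}
  measurable_timer _ := measurable_const
  timer_pos _ _ := ENNReal.zero_lt_top
  serve_available r h e := (lgfsRule_spec net r h e).1
  queue_available r h e := (lgfsRule_spec net r h e).2.2.2.2.1
  queue_ne_serve r h e := (lgfsRule_spec net r h e).2.2.2.2.2.1
  queue_le_buffer r h e := (lgfsRule_spec net r h e).2.2.2.2.2.2.1
  lost_only_if_full r h e l hl h1 h2 _ :=
    (lgfsRule_spec net r h e).2.2.2.2.2.2.2 l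
      (contenders_lgfsRule_subset net r h e (Or.inl hl)) h1 h2

lemma isPreemptiveLGFS_lgfsPolicy : (lgfsPolicy net).IsPreemptiveLGFS where
  timer_eq_top _ _ := rfl
  idle r h e he := Set.subset_empty_iff.1
    ((contenders_lgfsRule_subset net r h e).trans ((lgfsRule_spec net r h e).2.1 he).subset)
  freshest_first r h e l hl l' hl' :=
    (lgfsRule_spec net r h e).2.2.1 l hl l' (contenders_lgfsRule_subset net r h e hl')
  no_needless_preemption r h e c hc hmax := by
    refine (lgfsRule_spec net r h e).2.2.2.1 c hc fun l' hl' => ?_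
    cases hs : (lgfsRule net).serve r h e with
    | none => simp [(lgfsRule_spec net r h e).2.1 hs] at hl'
    | some m =>
      -- The hypothesis speaks of contenders only, but the served packet `m` is one of them and is
      -- freshest among all available packets.
      exact ((lgfsRule_spec net r h e).2.2.1 m hs l' hl').trans (hmax m (Or.inr (Or.inr hs)))

end MultihopAge
end

/-! ### From the coupling to the stochastic order and to expectations -/

noncomputable section

namespace MultihopAge

open Network

variable {net : Network} {R R' : Type*} [MeasurableSpace R] [MeasurableSpace R']

namespace CausalPolicy

instance (rate : net.Link → ℝ) (hrate : ∀ e, 0 < rate e) :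
    IsProbabilityMeasure (transmissionLaw rate hrate) := by
  have : ∀ p : net.Link × ℕ, IsProbabilityMeasure (expMeasure (rate p.1)) :=
    fun p => isProbabilityMeasure_expMeasure (hrate p.1)
  unfold transmissionLaw
  infer_instance

/-- With both randomizations frozen the almost sure order under the coupling carries one event into
the other. Only the two events need to be measurable, not `V`. -/
lemma IsPreemptiveLGFS.measure_le {P : CausalPolicy net R} (hP : P.IsPreemptiveLGFS)
    (π : CausalPolicy net R') (r : R) (r' : R') (rate : net.Link → ℝ) (hrate : ∀ e, 0 < rate e)
    {V : Set (ℝ≥0 → net.Node → ℝ)} (hV : IsUpperSet V)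
    (h : MeasurableSet {x | P.age (r, x) ∈ V}) (h' : MeasurableSet {x | π.age (r', x) ∈ V}) :
    transmissionLaw rate hrate {x | P.age (r, x) ∈ V} ≤
      transmissionLaw rate hrate {x | π.age (r', x) ∈ V} := by
  obtain ⟨γ, X, Y, hX, hY, hXY⟩ := hP.exists_coupling r π r' rate hrate
  rw [← hX.measure_preimage h.nullMeasurableSet, ← hY.measure_preimage h'.nullMeasurableSet]
  refine measure_mono_ae ?_
  filter_upwards [hXY] with w hw hx
  exact hV hw hx

lemma IsPreemptiveLGFS.integral_le {P : CausalPolicy net R} (hP : P.IsPreemptiveLGFS)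
    (π : CausalPolicy net R') (r : R) (r' : R') (rate : net.Link → ℝ) (hrate : ∀ e, 0 < rate e)
    {g : (ℝ≥0 → net.Node → ℝ) → ℝ} (hg : Monotone g)
    (h : Integrable (fun x => g (P.age (r, x))) (transmissionLaw rate hrate))
    (h' : Integrable (fun x => g (π.age (r', x))) (transmissionLaw rate hrate)) :
    ∫ x, g (P.age (r, x)) ∂transmissionLaw rate hrate ≤
      ∫ x, g (π.age (r', x)) ∂transmissionLaw rate hrate := by
  obtain ⟨γ, X, Y, hX, hY, hXY⟩ := hP.exists_coupling r π r' rate hrate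
  have hXi := hX.integrable_comp_of_integrable h
  have hYi := hY.integrable_comp_of_integrable h'
  have e1 := integral_map hX.aemeasurable (f := fun x => g (P.age (r, x)))
    (hX.map_eq.symm ▸ h.aestronglyMeasurable)
  have e2 := integral_map hY.aemeasurable (f := fun x => g (π.age (r', x)))
    (hY.map_eq.symm ▸ h'.aestronglyMeasurable)
  rw [hX.map_eq] at e1
  rw [hY.map_eq] at e2
  rw [e1, e2]
  refine integral_mono_ae hXi hYi ?_
  filter_upwards [hXY] with w hw
  exact hg hw

/-- The inequality holds for every pair of private randomizations, so these need no coupling of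
their own: a constant, the infimum over `r'`, separates the two sides. -/
theorem IsPreemptiveLGFS.stochasticallySmaller {P : CausalPolicy net R} (hP : P.IsPreemptiveLGFS)
    (π : CausalPolicy net R') (rate : net.Link → ℝ) (hrate : ∀ e, 0 < rate e)
    (ν : Measure R) [IsProbabilityMeasure ν] (ν' : Measure R') [IsProbabilityMeasure ν'] :
    StochasticallySmaller (ν.prod (transmissionLaw rate hrate)) P.age
      (ν'.prod (transmissionLaw rate hrate)) π.age := by
  refine ⟨fun t => (P.measurable_age t).aemeasurable, fun t => (π.measurable_age t).aemeasurable,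
    fun n t _ U hU hUm => ?_⟩
  have hV : IsUpperSet {f : ℝ≥0 → net.Node → ℝ | (fun i => f (t i)) ∈ U} :=
    fun f f' hf h => hU (fun i => hf (t i)) h
  have m1 : MeasurableSet {ω | (fun i => P.age ω (t i)) ∈ U} :=
    (measurable_pi_lambda _ fun i => P.measurable_age (t i)) hUm
  have m2 : MeasurableSet {ω | (fun i => π.age ω (t i)) ∈ U} :=
    (measurable_pi_lambda _ fun i => π.measurable_age (t i)) hUm
  rw [Measure.prod_apply m1, Measure.prod_apply m2]
  have key : ∀ r r', transmissionLaw rate hrate (Prod.mk r ⁻¹' {ω | (fun i => P.age ω (t i)) ∈ U}) ≤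
      transmissionLaw rate hrate (Prod.mk r' ⁻¹' {ω | (fun i => π.age ω (t i)) ∈ U}) := fun r r' =>
    hP.measure_le π r r' rate hrate hV (measurable_prodMk_left m1) (measurable_prodMk_left m2)
  calc _ ≤ ∫⁻ _, ⨅ r', transmissionLaw rate hrate
        (Prod.mk r' ⁻¹' {ω | (fun i => π.age ω (t i)) ∈ U}) ∂ν :=
        lintegral_mono fun r => le_iInf fun r' => key r r'
    -- The infimum is one constant, so its integral is the same for both probability measures.
    _ = ∫⁻ _, ⨅ r', transmissionLaw rate hrate
        (Prod.mk r' ⁻¹' {ω | (fun i => π.age ω (t i)) ∈ U}) ∂ν' := by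
        simp only [lintegral_const, measure_univ]
    _ ≤ _ := lintegral_mono fun r' => iInf_le _ r'

theorem IsPreemptiveLGFS.integral_age_le {P : CausalPolicy net R} (hP : P.IsPreemptiveLGFS)
    (π : CausalPolicy net R') (rate : net.Link → ℝ) (hrate : ∀ e, 0 < rate e)
    (ν : Measure R) [IsProbabilityMeasure ν] (ν' : Measure R') [IsProbabilityMeasure ν']
    {g : (ℝ≥0 → net.Node → ℝ) → ℝ} (hg : Monotone g)
    (h : Integrable (fun ω => g (P.age ω)) (ν.prod (transmissionLaw rate hrate)))
    (h' : Integrable (fun ω => g (π.age ω)) (ν'.prod (transmissionLaw rate hrate))) :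
    ∫ ω, g (P.age ω) ∂(ν.prod (transmissionLaw rate hrate)) ≤
      ∫ ω, g (π.age ω) ∂(ν'.prod (transmissionLaw rate hrate)) := by
  rw [integral_prod _ h, integral_prod _ h']
  -- Sections of an integrable function are integrable for almost every randomization only, so the
  -- comparison is made almost everywhere, first in `r'` and then in `r`.
  have step : ∀ᵐ r ∂ν, ∫ x, g (P.age (r, x)) ∂transmissionLaw rate hrate ≤
      ∫ r', ∫ x, g (π.age (r', x)) ∂transmissionLaw rate hrate ∂ν' := by
    filter_upwards [h.prod_right_ae] with r hr
    have : ∀ᵐ r' ∂ν', ∫ x, g (P.age (r, x)) ∂transmissionLaw rate hrate ≤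
        ∫ x, g (π.age (r', x)) ∂transmissionLaw rate hrate := by
      filter_upwards [h'.prod_right_ae] with r' hr'
      exact hP.integral_le π r r' rate hrate hg hr hr'
    simpa using integral_mono_ae (integrable_const _) h'.integral_prod_left this
  simpa using integral_mono_ae h.integral_prod_left (integrable_const _) step

end CausalPolicy

end MultihopAge
end

open MultihopAge MeasureTheory NNReal in
theorem theorem1 (net : Network) (rate : net.Link → ℝ) (hrate : ∀ e, 0 < rate e) :
    (∃ P : CausalPolicy net Unit, P.IsPreemptiveLGFS) ∧
    ∀ {R R' : Type*} [MeasurableSpace R] [MeasurableSpace R']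
      (ν : Measure R) [IsProbabilityMeasure ν] (ν' : Measure R') [IsProbabilityMeasure ν']
      (P : CausalPolicy net R) (_ : P.IsPreemptiveLGFS) (π : CausalPolicy net R'),
      StochasticallySmaller (ν.prod (transmissionLaw rate hrate)) P.age
        (ν'.prod (transmissionLaw rate hrate)) π.age ∧
      ∀ g : (ℝ≥0 → net.Node → ℝ) → ℝ, Monotone g →
        Integrable (fun ω => g (P.age ω)) (ν.prod (transmissionLaw rate hrate)) →
        Integrable (fun ω => g (π.age ω)) (ν'.prod (transmissionLaw rate hrate)) →
          ∫ ω, g (P.age ω) ∂(ν.prod (transmissionLaw rate hrate)) ≤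
            ∫ ω, g (π.age ω) ∂(ν'.prod (transmissionLaw rate hrate)) :=
  ⟨⟨lgfsPolicy net, isPreemptiveLGFS_lgfsPolicy net⟩, fun ν _ ν' _ _ hP π =>
    ⟨hP.stochasticallySmaller π rate hrate ν ν', fun _ hg h h' =>
      hP.integral_age_le π rate hrate ν ν' hg h h'⟩⟩
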